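/- **Setting (online knapsack with a bursty adversary plus random order).** Let $n,\ell\in\mathbb N$ and $k,\Gamma\in\mathbb R$ with $80\le k\le n/2$, $|\ell-\frac{n\ln k}{k}|<1$ (that is, $\ell$ is $\frac{n\ln k}{k}$ rounded up or down to an integer), $\Gamma\ge\sqrt k$ and $\frac{\Gamma\ell}{n}\le\frac12$. The times $[n]=\{1,\dots,n\}$ are partitioned into the windows $\{1,\dots,\ell\},\{\ell+1,\dots,2\ell\},\dots$ (the last one possibly shorter). An adversary chooses a set $RO\subseteq[n]$ such that $[n]\setminus RO$ is covered by at most $\Gamma$ windows, and items $(v_i,w_i)$, $1\le i\le|RO|$, with values $v_i\ge0$ and sizes $w_i\in[0,1]$. These items are assigned to the times in $RO$ by a uniformly random bijection $I$. At each time outside $RO$ the adversary presents an arbitrary item with value $\ge 0$ and size in $[0,1]$, which may depend on $I$ and on the behaviour (and internal randomness) of the algorithm. Let $V_t,W_t$ be the value and size of the item at time $t$. An online algorithm knows $n,k,\ell,\Gamma$ (but not $RO$) and decides irrevocably at each time $t$ whether to select the item, $X^{alg}_t\in\{0,1\}$, knowing only the items at times $1,\dots,t$. Let $\mathrm{OPT}_{RO}=\max\{\sum_i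 v_ix_i:\sum_i w_ix_i\le k,\ x\in[0,1]^{|RO|}\}$. **Primal algorithm.** Let $a_4>0$ be a constant. At time $t$ compute an optimal solution $X^t$ (by any rule that uses only the items seen so far) of the linear program: maximize $\sum_{t'\le t}V_{t'}X_{t'}$ over $X\in[0,1]^t$ subject to $\sum_{t'\le t}W_{t'}X_{t'}\le(1-\frac{4\Gamma\ell}{t})\frac tn k$ and $\sum_{t'\in B,\,t'\le t}W_{t'}X_{t'}\le 601\,\frac{\ell}{n}k$ for every window $B$. Select the item at time $t$ if and only if the program is feasible, $X^t_t>0$, the total size selected before time $t$ is at most $k-1$, and the total size selected before time $t$ within the window of $t$ is at most $a_4\frac{\ell}{n}k-1$. **Theorem.** There is a constant $a_0$ such that for every constant $a_4\ge a_0$ there is a constant $C>0$ (depending only on $a_4$) such that, for all $n,\ell,k,\Gamma$ as above: 1. The primal algorithm always returns a feasible solution, $\sum_{t\le n}W_tX^{alg}_t\le k$. If no two random-order items of positive size have the same value density $v_i/w_i$, then $$\mathbb E\Big[\sum_{t\in RO}V_tX^{alg}_t\Big]\ge\Big(1-C\,\frac{\Gamma\ell}{n}\ln\frac{n}{\Gamma\ell}\Big)\mathrm{OPT}_{RO}\quad\text{and}\quad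 \mathbb E\Big[\sum_{t\in RO}V_tX^{alg}_t\Big]\ge\Big(1-C\,\frac{\Gamma\ln k}{k}\ln\frac{k}{\Gamma\ln k}\Big)\mathrm{OPT}_{RO}.$$ 2. There is a randomized online algorithm whose solution is always feasible and which satisfies both inequalities of part 1 for all instances, with no condition on the value densities. -/

import Mathlib

open scoped BigOperators

noncomputable section

namespace BARO

/-- An item of the knapsack problem. -/
structure Item where
  value : ℝ
  size : ℝ

/-- Admissible items: nonnegative value and size in `[0, 1]`. -/
def Item.Valid (x : Item) : Prop :=
  0 ≤ x.value ∧ 0 ≤ x.size ∧ x.size ≤ 1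

/-- Time steps are `Fin n`; the element `t : Fin n` is the `(t + 1)`-st time step. The windows
`{1, …, ℓ}, {ℓ + 1, …, 2ℓ}, …` are numbered `0, 1, …`; this is the number of the window of `t`. -/
def window (ℓ : ℕ) {n : ℕ} (t : Fin n) : ℕ := (t : ℕ) / ℓ

/-- A (deterministic) online algorithm: from the sequence of items it determines the set of times
whose items are selected, and whether `t` is selected depends only on the items up to `t`. -/
structure OnlineAlg (n : ℕ) where
  select : (Fin n → Item) → Finset (Fin n)
  online : ∀ (x y : Fin n → Item) (t : Fin n), (∀ s ≤ t, x s = y s) →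
    (t ∈ select x ↔ t ∈ select y)

/-- The selections fit the knapsack of size `k`, on every sequence of admissible items. -/
def OnlineAlg.Feasible {n : ℕ} (A : OnlineAlg n) (k : ℝ) : Prop :=
  ∀ x : Fin n → Item, (∀ t, (x t).Valid) → ∑ t ∈ A.select x, (x t).size ≤ k

/-! ### The linear programs and the algorithm -/

/-- Feasible solutions of the linear program at time `t`. The program has one variable for each
time up to `t`; the remaining coordinates are set to `0`. -/
structure LPFeasible {n : ℕ} (ℓ : ℕ) (k Γ : ℝ) (x : Fin n → Item) (t : Fin n) (X : Fin n → ℝ) :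
    Prop where
  nonneg : ∀ s, 0 ≤ X s
  le_one : ∀ s, X s ≤ 1
  future : ∀ s, t < s → X s = 0
  budget : ∑ s ∈ Finset.Iic t, (x s).size * X s ≤
    (1 - 4 * Γ * ℓ / ((t : ℝ) + 1)) * (((t : ℝ) + 1) / n) * k
  inner : ∀ j : ℕ, ∑ s ∈ Finset.Iic t with window ℓ s = j, (x s).size * X s ≤ 601 * (ℓ / n) * k

/-- Optimal solutions of the linear program at time `t`. -/
def LPOptimal {n : ℕ} (ℓ : ℕ) (k Γ : ℝ) (x : Fin n → Item) (t : Fin n) (X : Fin n → ℝ) : Prop :=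
  LPFeasible ℓ k Γ x t X ∧ ∀ Y, LPFeasible ℓ k Γ x t Y →
    ∑ s ∈ Finset.Iic t, (x s).value * Y s ≤ ∑ s ∈ Finset.Iic t, (x s).value * X s

/-- A rule that, from the items up to time `t`, computes an optimal solution of the linear program
at time `t` whenever this program has a feasible solution. -/
structure LPSolver (n ℓ : ℕ) (k Γ : ℝ) where
  sol : (Fin n → Item) → Fin n → Fin n → ℝ
  optimal : ∀ x t, (∃ X, LPFeasible ℓ k Γ x t X) → LPOptimal ℓ k Γ x t (sol x t)
  online : ∀ (x y : Fin n → Item) (t : Fin n), (∀ s ≤ t, x s = y s) → sol x t = sol y t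

/-- The item at time `t` is tentatively picked: the computed optimal solution of the linear program
at time `t` is positive at `t`. (Nothing is picked if the program is infeasible, which can only
happen while its budget is negative.) -/
def Tentative {n ℓ : ℕ} {k Γ : ℝ} (S : LPSolver n ℓ k Γ) (x : Fin n → Item) (t : Fin n) : Prop :=
  (∃ X, LPFeasible ℓ k Γ x t X) ∧ 0 < S.sol x t t

/-- The item at time `t` is picked, when `A` is the set of earlier selected times: it is
tentatively picked and `A` satisfies the main budget constraint and the outer constraint. -/
def Accept {n ℓ : ℕ} {k Γ : ℝ} (a₄ : ℝ) (S : LPSolver n ℓ k Γ) (x : Fin n → Item)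
    (A : Finset (Fin n)) (t : Fin n) : Prop :=
  Tentative S x t ∧ ∑ s ∈ A, (x s).size ≤ k - 1 ∧
    ∑ s ∈ A with window ℓ s = window ℓ t, (x s).size ≤ a₄ * (ℓ / n) * k - 1

open Classical in
/-- The times selected by the primal algorithm among the first `i` time steps. -/
def primalSelect {n ℓ : ℕ} {k Γ : ℝ} (a₄ : ℝ) (S : LPSolver n ℓ k Γ) (x : Fin n → Item) :
    ℕ → Finset (Fin n)
  | 0 => ∅
  | i + 1 =>
    if h : i < n then
      if Accept a₄ S x (primalSelect a₄ S x i) ⟨i, h⟩ then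
        insert ⟨i, h⟩ (primalSelect a₄ S x i)
      else primalSelect a₄ S x i
    else primalSelect a₄ S x i

theorem lt_of_mem_primalSelect {n ℓ : ℕ} {k Γ : ℝ} (a₄ : ℝ) (S : LPSolver n ℓ k Γ)
    (x : Fin n → Item) (i : ℕ) (t : Fin n) (ht : t ∈ primalSelect a₄ S x i) : (t : ℕ) < i := by
  induction i with
  | zero => simp [primalSelect] at ht
  | succ i ih =>
    rw [primalSelect] at ht
    split_ifs at ht with h h'
    · rcases Finset.mem_insert.1 ht with rfl | ht
      · exact Nat.lt_succ_self i
      · exact (ih ht).trans (Nat.lt_succ_self i)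
    · exact (ih ht).trans (Nat.lt_succ_self i)
    · exact (ih ht).trans (Nat.lt_succ_self i)

theorem LPFeasible.congr {n ℓ : ℕ} {k Γ : ℝ} {x y : Fin n → Item} {t : Fin n}
    (h : ∀ s ≤ t, x s = y s) {X : Fin n → ℝ} (hX : LPFeasible ℓ k Γ x t X) :
    LPFeasible ℓ k Γ y t X where
  nonneg := hX.nonneg
  le_one := hX.le_one
  future := hX.future
  budget := by
    refine le_trans (le_of_eq (Finset.sum_congr rfl fun s hs => ?_)) hX.budget
    rw [h s (Finset.mem_Iic.1 hs)]
  inner j := by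
    refine le_trans (le_of_eq (Finset.sum_congr rfl fun s hs => ?_)) (hX.inner j)
    rw [h s (Finset.mem_Iic.1 (Finset.mem_filter.1 hs).1)]

theorem Accept.congr {n ℓ : ℕ} {k Γ : ℝ} {a₄ : ℝ} {S : LPSolver n ℓ k Γ} {x y : Fin n → Item}
    {t : Fin n} (h : ∀ s ≤ t, x s = y s) {A : Finset (Fin n)} (hA : ∀ s ∈ A, s ≤ t)
    (hx : Accept a₄ S x A t) : Accept a₄ S y A t := by
  obtain ⟨⟨⟨X, hX⟩, hpos⟩, h₁, h₂⟩ := hx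
  refine ⟨⟨⟨X, hX.congr h⟩, S.online x y t h ▸ hpos⟩, ?_, ?_⟩
  · refine le_trans (le_of_eq (Finset.sum_congr rfl fun s hs => ?_)) h₁
    rw [h s (hA s hs)]
  · refine le_trans (le_of_eq (Finset.sum_congr rfl fun s hs => ?_)) h₂
    rw [h s (hA s (Finset.mem_filter.1 hs).1)]

theorem primalSelect_congr {n ℓ : ℕ} {k Γ : ℝ} (a₄ : ℝ) (S : LPSolver n ℓ k Γ)
    {x y : Fin n → Item} (i : ℕ) (h : ∀ s : Fin n, (s : ℕ) < i → x s = y s) :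
    primalSelect a₄ S x i = primalSelect a₄ S y i := by
  induction i with
  | zero => rfl
  | succ i ih =>
    have ih' := ih fun s hs => h s (hs.trans (Nat.lt_succ_self i))
    rw [primalSelect, primalSelect, ih']
    by_cases hi : i < n
    · have hxy : ∀ s ≤ (⟨i, hi⟩ : Fin n), x s = y s := fun s hs =>
        h s (Nat.lt_succ_of_le (Fin.le_def.1 hs))
      have hA : ∀ s ∈ primalSelect a₄ S y i, s ≤ (⟨i, hi⟩ : Fin n) := fun s hs =>
        Fin.le_def.2 (lt_of_mem_primalSelect a₄ S y i s hs).le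
      have hiff : Accept a₄ S x (primalSelect a₄ S y i) ⟨i, hi⟩ ↔
          Accept a₄ S y (primalSelect a₄ S y i) ⟨i, hi⟩ :=
        ⟨fun H => H.congr hxy hA, fun H => H.congr (fun s hs => (hxy s hs).symm) hA⟩
      rw [dif_pos hi, dif_pos hi]
      by_cases hacc : Accept a₄ S y (primalSelect a₄ S y i) ⟨i, hi⟩
      · rw [if_pos hacc, if_pos (hiff.2 hacc)]
      · rw [if_neg hacc, if_neg fun H => hacc (hiff.1 H)]
    · simp only [hi, dif_neg, not_false_eq_true]

theorem mem_primalSelect_iff {n ℓ : ℕ} {k Γ : ℝ} (a₄ : ℝ) (S : LPSolver n ℓ k Γ)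
    (x : Fin n → Item) (t : Fin n) (i : ℕ) (hi : (t : ℕ) + 1 ≤ i) :
    t ∈ primalSelect a₄ S x i ↔ t ∈ primalSelect a₄ S x ((t : ℕ) + 1) := by
  induction i, hi using Nat.le_induction with
  | base => rfl
  | succ i hi ih =>
    rw [← ih, primalSelect]
    split_ifs with h h'
    · have hne : t ≠ ⟨i, h⟩ := fun H => by
        have := congrArg Fin.val H
        simp at this
        omega
      simp [Finset.mem_insert, hne]
    · rfl
    · rfl

/-- The primal algorithm with window-based inner and outer constraints. -/
def primalAlg {n ℓ : ℕ} {k Γ : ℝ} (a₄ : ℝ) (S : LPSolver n ℓ k Γ) : OnlineAlg n where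
  select x := primalSelect a₄ S x n
  online x y t h := by
    rw [mem_primalSelect_iff a₄ S x t n t.isLt, mem_primalSelect_iff a₄ S y t n t.isLt,
      primalSelect_congr a₄ S _ fun s hs => h s (Fin.le_def.2 (Nat.lt_succ_iff.1 hs))]

/-! ### The bursty adversary plus random order -/

/-- The choices of the adversary. `RO` is the set of random-order times; the other times are
adversarial and are covered by at most `Γ` windows. `item` lists the random-order items. An
assignment `I` of these items to the random-order times is drawn uniformly. The items at the
adversarial times are arbitrary functions of `I` and of the internal randomness `ω : Ω` of the
algorithm, hence in particular may react to the behaviour of the algorithm. -/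
structure Instance (n ℓ : ℕ) (Γ : ℝ) (Ω : Type) where
  RO : Finset (Fin n)
  cover : Finset ℕ
  card_cover : (cover.card : ℝ) ≤ Γ
  covers : ∀ t, t ∉ RO → window ℓ t ∈ cover
  item : Fin RO.card → Item
  item_valid : ∀ i, (item i).Valid
  adv : ({t // t ∈ RO} ≃ Fin RO.card) → Ω → Fin n → Item
  adv_valid : ∀ I ω t, (adv I ω t).Valid

namespace Instance

variable {n ℓ : ℕ} {Γ : ℝ} {Ω : Type}

/-- The sequence of items that is presented to the algorithm. -/
def arrival (B : Instance n ℓ Γ Ω) (I : {t // t ∈ B.RO} ≃ Fin B.RO.card) (ω : Ω) (t : Fin n) :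
    Item :=
  if h : t ∈ B.RO then B.item (I ⟨t, h⟩) else B.adv I ω t

/-- The fractional offline optimum of the random-order items. (The set is nonempty and bounded,
and the supremum is attained.) -/
def optRO (B : Instance n ℓ Γ Ω) (k : ℝ) : ℝ :=
  sSup {r | ∃ X : Fin B.RO.card → ℝ, (∀ i, 0 ≤ X i ∧ X i ≤ 1) ∧
    ∑ i, (B.item i).size * X i ≤ k ∧ r = ∑ i, (B.item i).value * X i}

/-- No two random-order items of positive size have the same value density. -/
def DistinctDensities (B : Instance n ℓ Γ Ω) : Prop :=
  ∀ i j, i ≠ j → 0 < (B.item i).size → 0 < (B.item j).size →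
    (B.item i).value / (B.item i).size ≠ (B.item j).value / (B.item j).size

/-- The expected value that the algorithm collects at the random-order times, where the internal
randomness `ω` of the algorithm is uniform on `Ω`, and the assignment `I` is uniform and
independent of `ω`. -/
def expectedValue [Fintype Ω] (B : Instance n ℓ Γ Ω) (A : Ω → OnlineAlg n) : ℝ :=
  𝔼 ω : Ω, 𝔼 I : {t // t ∈ B.RO} ≃ Fin B.RO.card,
    ∑ t ∈ B.RO with t ∈ (A ω).select (B.arrival I ω), (B.arrival I ω t).value

/-- The algorithm attains the competitive ratio on `B`, with constant `C` in the error terms. -/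
def Attains [Fintype Ω] (B : Instance n ℓ Γ Ω) (A : Ω → OnlineAlg n) (k C : ℝ) : Prop :=
  (1 - C * ((Γ * ℓ / n) * Real.log (n / (Γ * ℓ)))) * B.optRO k ≤ B.expectedValue A ∧
  (1 - C * ((Γ * Real.log k / k) * Real.log (k / (Γ * Real.log k)))) * B.optRO k
    ≤ B.expectedValue A

end Instance

end BARO

end

/-! Write L = ℓk/n, the share of the budget that belongs to one window; it equals ln k up to 1/2.
Let the load of an item be the total size of the random-order items that are at least as dense. If
densities are distinct, the items of load at most K have total size above K - 1 (or are all items),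
so they are worth at least (K - 1)/k of the optimum (`mul_sum_value_le`).

Call an order typical if every uncovered window receives at most 600L from the items of load at most
k + 1, and every prefix that ends at a window boundary receives at least its mean minus ΓL. Then
exchange arguments in the linear program give two facts. Outside the covered windows, no item of
load above k + 1 is tentatively picked: the denser items seen so far would already overfill the
budget, which was lowered by 4ΓL for this purpose (`Typical.load_le`). Conversely, an item of load
at most k(1 - 609Γℓ/t) at an uncovered t-th step is tentatively picked: otherwise the budget would
be tight, although the covered windows use at most 601ΓL and the denser items are too few to use the
rest, provided the prefix up to t is not overfull (`Typical.pos_of_load_le`). By the first fact the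
knapsack fills at rate about k/n, apart from a₄ΓL lost to the adversary, so such an item is really
selected unless t is close to n (`Typical.mem_select`).

Sampling without replacement has exponential moments no larger than independent sampling
(`expect_prod_le`). A window overflows with probability at most exp(-2L), and since Γ ≥ √k a prefix
deviates by ΓL with probability at most exp(-L²/32); both are O(1/k²), and there are O(k) windows.
Conditioning on which item arrives at t costs one exchange of samples (`le_card_mul_prob_cond`). So
step t contributes a 1/n share of the optimum with relative loss O(Γℓ/t) + O(1/k), and the harmonic
sum of Γℓ/t is the source of the logarithm.

Ties are removed by tiny random scalings of the values. The algorithm can only label times, but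
since the arrival order is a bijection, uniform labels of times are as good as uniform labels of
items (`Instance.expect_scaled_le`). -/

noncomputable section

namespace BARO

open Finset

/-! ### Uniformly random bijections -/

section RandomBijection

variable {α β : Type*} [Fintype α] [Fintype β] [DecidableEq α] [DecidableEq β]

theorem expect_comp_swap (a b : α) (F : (α ≃ β) → ℝ) :
    𝔼 I : α ≃ β, F ((Equiv.swap a b).trans I) = 𝔼 I : α ≃ β, F I := by
  refine Fintype.expect_equiv ⟨fun I => (Equiv.swap a b).trans I,
    fun I => (Equiv.swap a b).trans I, fun I => ?_, fun I => ?_⟩ _ _ fun I => rfl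
  · ext s; simp
  · ext s; simp

theorem prod_comp_swap_of_notMem {α β : Type*} [DecidableEq α] {a b : α} {A : Finset α} (ha : a ∉ A) (hb : b ∉ A)
    (f : β → ℝ) (I : α ≃ β) :
    ∏ s ∈ A, f ((Equiv.swap a b).trans I s) = ∏ s ∈ A, f (I s) := by
  refine prod_congr rfl fun s hs => ?_
  rw [Equiv.trans_apply, Equiv.swap_apply_of_ne_of_ne]
  · rintro rfl; exact ha hs
  · rintro rfl; exact hb hs

/-- A new sample is negatively correlated with a product over earlier samples. -/
theorem expect_prod_mul_le {f : β → ℝ} (hf : ∀ i, 0 ≤ f i) {A : Finset α} {a : α} (ha : a ∉ A)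
    (b : α) :
    𝔼 I : α ≃ β, (∏ s ∈ A, f (I s)) * f (I a) ≤ 𝔼 I : α ≃ β, (∏ s ∈ A, f (I s)) * f (I b) := by
  by_cases hb : b ∈ A
  · have hsplit : ∀ I : α ≃ β, ∏ s ∈ A, f (I s) = (∏ s ∈ A.erase b, f (I s)) * f (I b) :=
      fun I => (prod_erase_mul A (fun s => f (I s)) hb).symm
    have ha' : a ∉ A.erase b := fun h => ha (mem_of_mem_erase h)
    have key : 𝔼 I : α ≃ β, (∏ s ∈ A.erase b, f (I s)) * f (I a) ^ 2
        = 𝔼 I : α ≃ β, (∏ s ∈ A.erase b, f (I s)) * f (I b) ^ 2 := by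
      rw [← expect_comp_swap a b]
      refine expect_congr rfl fun I _ => ?_
      rw [prod_comp_swap_of_notMem ha' (notMem_erase b A)]
      simp
    -- AM-GM on f (I a) * f (I b); by `key` the two squares have equal expectations.
    have : 𝔼 I : α ≃ β, (∏ s ∈ A, f (I s)) * f (I a) ≤
        𝔼 I : α ≃ β, (((∏ s ∈ A.erase b, f (I s)) * f (I a) ^ 2) * (1 / 2) +
          ((∏ s ∈ A.erase b, f (I s)) * f (I b) ^ 2) * (1 / 2)) := by
      refine expect_le_expect fun I _ => ?_
      rw [hsplit]
      have h0 : 0 ≤ ∏ s ∈ A.erase b, f (I s) := prod_nonneg fun s _ => hf _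
      nlinarith [mul_nonneg h0 (sq_nonneg (f (I a) - f (I b)))]
    rw [expect_add_distrib, ← expect_mul, ← expect_mul, key, ← mul_add] at this
    norm_num at this
    refine this.trans_eq (expect_congr rfl fun I _ => ?_)
    rw [hsplit]; ring
  · refine le_of_eq ?_
    rw [← expect_comp_swap a b]
    refine expect_congr rfl fun I _ => ?_
    rw [prod_comp_swap_of_notMem ha hb]
    simp

/-- Maclaurin's inequality for sampling without replacement. -/
theorem expect_prod_le {f : β → ℝ} (hf : ∀ i, 0 ≤ f i) (A : Finset α) :
    𝔼 I : α ≃ β, ∏ s ∈ A, f (I s) ≤ (𝔼 i, f i) ^ A.card := by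
  induction A using Finset.induction_on with
  | empty =>
    rcases isEmpty_or_nonempty (α ≃ β) with h | h
    · simp
    · simp
  | insert a A ha ih =>
    have hμ : 0 ≤ 𝔼 i, f i := expect_nonneg fun i _ => hf i
    have h1 : 𝔼 I : α ≃ β, ∏ s ∈ insert a A, f (I s)
        = 𝔼 I : α ≃ β, (∏ s ∈ A, f (I s)) * f (I a) :=
      expect_congr rfl fun I _ => by rw [prod_insert ha, mul_comm]
    -- The bound holds for every b, hence on average over b; the average of f (I b) over all b is
    -- the constant mean of f, which decouples the new factor.
    have h2 : (𝔼 I : α ≃ β, (∏ s ∈ A, f (I s)) * f (I a))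
        ≤ 𝔼 b : α, 𝔼 I : α ≃ β, (∏ s ∈ A, f (I s)) * f (I b) := by
      have : Nonempty α := ⟨a⟩
      exact le_expect univ_nonempty fun b _ => expect_prod_mul_le hf ha b
    have h3 : 𝔼 b : α, 𝔼 I : α ≃ β, (∏ s ∈ A, f (I s)) * f (I b)
        = (𝔼 I : α ≃ β, ∏ s ∈ A, f (I s)) * 𝔼 i, f i := by
      rw [expect_comm, expect_mul]
      refine expect_congr rfl fun I _ => ?_
      rw [← mul_expect]
      congr 1
      exact Fintype.expect_equiv I _ _ fun b => rfl
    rw [h1, card_insert_of_notMem ha, pow_succ]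
    exact (h2.trans_eq h3).trans (mul_le_mul_of_nonneg_right ih hμ)

/-- Maclaurin's inequality reduces this to one sample, where exp z ≤ 1 + z + z² for |z| ≤ 1 and g² ≤
g apply. Both signs of c are needed, for the two tails. -/
theorem expect_exp_sum_le {g : β → ℝ} (h0 : ∀ i, 0 ≤ g i) (h1 : ∀ i, g i ≤ 1) (A : Finset α)
    {c : ℝ} (hc : |c| ≤ 1) :
    𝔼 I : α ≃ β, Real.exp (c * ∑ s ∈ A, g (I s)) ≤
      Real.exp ((c + c ^ 2) * (A.card * (𝔼 i, g i))) := by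
  have hE : 𝔼 I : α ≃ β, Real.exp (c * ∑ s ∈ A, g (I s))
      = 𝔼 I : α ≃ β, ∏ s ∈ A, Real.exp (c * g (I s)) :=
    expect_congr rfl fun I _ => by rw [mul_sum, Real.exp_sum]
  have hpt : ∀ i, Real.exp (c * g i) ≤ 1 + (c + c ^ 2) * g i := fun i => by
    have habs : |c * g i| ≤ 1 := by
      rw [abs_mul, abs_of_nonneg (h0 i)]
      exact mul_le_one₀ hc (h0 i) (h1 i)
    have := (abs_le.1 (Real.abs_exp_sub_one_sub_id_le habs)).2
    nlinarith [mul_nonneg (sq_nonneg c) (mul_nonneg (h0 i) (sub_nonneg.2 (h1 i)))]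
  have hmean : 𝔼 i, Real.exp (c * g i) ≤ Real.exp ((c + c ^ 2) * 𝔼 i, g i) := by
    rcases isEmpty_or_nonempty β with hβ | hβ
    · simp
    · calc 𝔼 i, Real.exp (c * g i) ≤ 𝔼 i, (1 + (c + c ^ 2) * g i) :=
            expect_le_expect fun i _ => hpt i
        _ = 1 + (c + c ^ 2) * 𝔼 i, g i := by
            rw [expect_add_distrib, ← mul_expect, expect_const univ_nonempty]
        _ ≤ _ := by rw [add_comm]; exact Real.add_one_le_exp _
  rw [hE]
  refine (expect_prod_le (f := fun i => Real.exp (c * g i))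
    (fun i => (Real.exp_pos _).le) A).trans ?_
  refine (pow_le_pow_left₀ (expect_nonneg fun i _ => (Real.exp_pos _).le) hmean _).trans_eq ?_
  rw [← Real.exp_nat_mul]
  congr 1; ring

open Classical in
/-- The probability of an event under the uniform distribution. -/
def prob {ι : Type*} [Fintype ι] (p : ι → Prop) : ℝ := 𝔼 i, if p i then 1 else 0

theorem prob_le_of_le {ι : Type*} [Fintype ι] {p : ι → Prop} {F : ι → ℝ} (h0 : ∀ i, 0 ≤ F i)
    (h1 : ∀ i, p i → 1 ≤ F i) : prob p ≤ 𝔼 i, F i :=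
  expect_le_expect fun i _ => by
    split_ifs with h
    · exact h1 i h
    · exact h0 i

theorem prob_or_le {ι : Type*} [Fintype ι] (p q : ι → Prop) :
    prob (fun i => p i ∨ q i) ≤ prob p + prob q := by
  rw [prob, prob, prob, ← expect_add_distrib]
  refine expect_le_expect fun i _ => ?_
  by_cases hp : p i <;> by_cases hq : q i <;> simp [hp, hq]

theorem prob_exists_le {ι κ : Type*} [Fintype ι] (s : Finset κ) (p : κ → ι → Prop) {c : ℝ}
    (h : ∀ j ∈ s, prob (p j) ≤ c) : prob (fun i => ∃ j ∈ s, p j i) ≤ s.card * c := by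
  classical
  induction s using Finset.induction_on with
  | empty => simp [prob]
  | insert j s hj ih =>
    have h1 : prob (fun i => ∃ j' ∈ insert j s, p j' i) =
        prob (fun i => p j i ∨ ∃ j' ∈ s, p j' i) := by
      congr 1; funext i; simp
    rw [h1, card_insert_of_notMem hj]
    push_cast
    have := prob_or_le (p j) (fun i => ∃ j' ∈ s, p j' i)
    have h2 := ih fun j' hj' => h j' (mem_insert_of_mem hj')
    have h3 := h j (mem_insert_self j s)
    linarith

/-- Markov's inequality for the exponential. The rate c stays free: windows use c = 1, prefixes a
rate that depends on the allowed deviation. -/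
theorem prob_upper_tail_le {g : β → ℝ} (h0 : ∀ i, 0 ≤ g i) (h1 : ∀ i, g i ≤ 1) (A : Finset α)
    {c : ℝ} (hc0 : 0 ≤ c) (hc : c ≤ 1) (r : ℝ) :
    prob (fun I : α ≃ β => r ≤ ∑ s ∈ A, g (I s)) ≤
      Real.exp ((c + c ^ 2) * (A.card * (𝔼 i, g i)) - c * r) := by
  have : prob (fun I : α ≃ β => r ≤ ∑ s ∈ A, g (I s)) ≤
      𝔼 I : α ≃ β, Real.exp (c * ∑ s ∈ A, g (I s)) * Real.exp (-(c * r)) :=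
    prob_le_of_le (fun I => by positivity) fun I hI => by
      rw [← Real.exp_add]
      exact Real.one_le_exp (by nlinarith)
  refine this.trans ?_
  rw [← expect_mul, sub_eq_add_neg, Real.exp_add]
  exact mul_le_mul_of_nonneg_right
    (expect_exp_sum_le h0 h1 A (by rwa [abs_of_nonneg hc0])) (Real.exp_pos _).le

theorem prob_lower_tail_le {g : β → ℝ} (h0 : ∀ i, 0 ≤ g i) (h1 : ∀ i, g i ≤ 1) (A : Finset α)
    {c : ℝ} (hc0 : 0 ≤ c) (hc : c ≤ 1) (r : ℝ) :
    prob (fun I : α ≃ β => ∑ s ∈ A, g (I s) ≤ r) ≤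
      Real.exp ((-c + c ^ 2) * (A.card * (𝔼 i, g i)) + c * r) := by
  have : prob (fun I : α ≃ β => ∑ s ∈ A, g (I s) ≤ r) ≤
      𝔼 I : α ≃ β, Real.exp (-c * ∑ s ∈ A, g (I s)) * Real.exp (c * r) :=
    prob_le_of_le (fun I => by positivity) fun I hI => by
      rw [← Real.exp_add]
      exact Real.one_le_exp (by nlinarith)
  refine this.trans ?_
  rw [← expect_mul, Real.exp_add]
  have := expect_exp_sum_le (α := α) h0 h1 A (c := -c) (by rwa [abs_neg, abs_of_nonneg hc0])
  rw [neg_sq] at this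
  exact mul_le_mul_of_nonneg_right this (Real.exp_pos _).le

/-- Exchanging two samples changes a partial sum by at most one. -/
theorem abs_sum_comp_swap_sub_le {α : Type*} [DecidableEq α] {h : α → ℝ} (h0 : ∀ s, 0 ≤ h s) (h1 : ∀ s, h s ≤ 1)
    (A : Finset α) (a b : α) :
    |∑ s ∈ A, h (Equiv.swap a b s) - ∑ s ∈ A, h s| ≤ 1 := by
  have hpt : ∀ s, h (Equiv.swap a b s) - h s =
      (if s = a then h b - h a else 0) + (if s = b then h a - h b else 0) := fun s => by
    by_cases ha : s = a
    · subst ha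
      by_cases hb : s = b
      · subst hb; simp
      · simp [hb]
    · by_cases hb : s = b
      · subst hb; simp [ha]
      · simp [ha, hb, Equiv.swap_apply_of_ne_of_ne ha hb]
  rw [← sum_sub_distrib, sum_congr rfl fun s _ => hpt s, sum_add_distrib, sum_ite_eq', sum_ite_eq',
    abs_le]
  have := h0 a; have := h0 b; have := h1 a; have := h1 b
  split_ifs <;> constructor <;> linarith

/-- Conditioning a random bijection on one value, by exchanging two samples. -/
theorem card_mul_expect_cond (a : α) (i : β) (F : (α ≃ β) → ℝ) :
    ∑ b : α, 𝔼 I : α ≃ β, (if I a = i then F ((Equiv.swap a b).trans I) else 0) =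
      𝔼 I : α ≃ β, F I := by
  have h : ∀ b : α, 𝔼 I : α ≃ β, (if I a = i then F ((Equiv.swap a b).trans I) else 0) =
      𝔼 I : α ≃ β, (if I b = i then F I else 0) := fun b => by
    rw [← expect_comp_swap a b]
    refine expect_congr rfl fun I _ => ?_
    have : (Equiv.swap a b).trans ((Equiv.swap a b).trans I) = I := by ext s; simp
    rw [this]; simp
  rw [sum_congr rfl fun b _ => h b, ← expect_sum_comm]
  refine expect_congr rfl fun I _ => ?_
  -- The value i is taken at exactly one b, so the events I b = i partition the bijections.
  rw [Fintype.sum_eq_single (I.symm i)]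
  · simp
  · intro b hb
    rw [if_neg]
    rintro rfl
    simp at hb

/-- If a bad event becomes the event `q` after every exchange with `a`, then conditioned on
`I a = i` it is at most as likely as `q`. -/
theorem le_card_mul_prob_cond [Nonempty (α ≃ β)] (a : α) (i : β) {p q : (α ≃ β) → Prop}
    (h : ∀ I b, p I → q ((Equiv.swap a b).trans I)) :
    1 - prob q ≤ Fintype.card α * prob fun I : α ≃ β => I a = i ∧ ¬ p I := by
  classical
  have h1 := card_mul_expect_cond a i fun I => if q I then (0 : ℝ) else 1
  have h2 : 𝔼 I : α ≃ β, (if q I then (0 : ℝ) else 1) = 1 - prob q := by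
    rw [prob, eq_sub_iff_add_eq, ← expect_add_distrib]
    rw [← expect_const (s := (univ : Finset (α ≃ β))) univ_nonempty (1 : ℝ)]
    refine expect_congr rfl fun I _ => ?_
    by_cases hq : q I <;> simp [hq]
  rw [← h2, ← h1, ← nsmul_eq_mul, ← card_univ, ← sum_const]
  refine sum_le_sum fun b _ => expect_le_expect fun I _ => ?_
  by_cases hI : I a = i
  · by_cases hp : p I
    · simp [h I b hp, hp]
    · simp only [hI, hp]; split_ifs <;> simp_all
  · simp [hI]

end RandomBijection

/-! ### Items sorted by density -/

section Density

/-- The value density of an item (meaningful if the size is positive). -/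
def Item.density (y : Item) : ℝ := y.value / y.size

theorem Item.Valid.density_nonneg {y : Item} (hy : y.Valid) : 0 ≤ y.density :=
  div_nonneg hy.1 hy.2.1

theorem Item.value_eq_density_mul {y : Item} (hy : 0 < y.size) :
    y.value = y.density * y.size := by
  rw [Item.density, div_mul_cancel₀ _ hy.ne']

variable {ι : Type*} [Fintype ι] {it : ι → Item}

open Classical in
/-- The total size of the items of the list `it` that are at least as dense as `y`. -/
def load (it : ι → Item) (y : Item) : ℝ :=
  if 0 < y.size then ∑ i with y.density ≤ (it i).density, (it i).size else 0

open Classical in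
/-- The size of `y`, if `y` belongs to the densest items of total size `K`, and `0` otherwise. -/
def topSize (it : ι → Item) (K : ℝ) (y : Item) : ℝ := if load it y ≤ K then y.size else 0

open Classical in
/-- The densest items of total size `K`. -/
def top (it : ι → Item) (K : ℝ) : Finset ι := {i | load it (it i) ≤ K}

theorem mem_top {K : ℝ} {i : ι} : i ∈ top it K ↔ load it (it i) ≤ K := by simp [top]

theorem load_nonneg (hv : ∀ i, (it i).Valid) (y : Item) : 0 ≤ load it y := by
  unfold load
  split_ifs
  · exact sum_nonneg fun i _ => (hv i).2.1
  · exact le_rfl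

/-- An item of size zero has load 0 by convention, so it is always in the top and its junk density
(a division by zero) does no harm as z. -/
theorem load_anti (hv : ∀ i, (it i).Valid) {y z : Item} (hy : 0 < y.size)
    (h : y.density ≤ z.density) : load it z ≤ load it y := by
  by_cases hz : 0 < z.size
  · rw [load, load, if_pos hy, if_pos hz]
    refine sum_le_sum_of_subset_of_nonneg (fun i hi => ?_) fun i _ _ => (hv i).2.1
    simp only [mem_filter, mem_univ, true_and] at hi ⊢
    exact h.trans hi
  · rw [load, if_neg hz]
    exact load_nonneg hv y

theorem size_pos_of_lt_load {K : ℝ} (hK : 0 ≤ K) {y : Item} (h : K < load it y) : 0 < y.size := by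
  by_contra hy
  rw [load, if_neg hy] at h
  exact absurd h hK.not_gt

theorem topSize_nonneg {y : Item} (hy : y.Valid) (K : ℝ) : 0 ≤ topSize it K y := by
  unfold topSize
  split_ifs
  · exact hy.2.1
  · exact le_rfl

theorem topSize_le_one {y : Item} (hy : y.Valid) (K : ℝ) : topSize it K y ≤ 1 := by
  unfold topSize
  split_ifs
  · exact hy.2.2
  · exact zero_le_one

theorem sum_topSize (K : ℝ) : ∑ i, topSize it K (it i) = ∑ i ∈ top it K, (it i).size := by
  classical
  simp only [topSize, top]
  rw [sum_filter]

/-- The least dense nonempty item of the top has a load that counts the whole top. -/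
theorem sum_topSize_le (hv : ∀ i, (it i).Valid) {K : ℝ} (hK : 0 ≤ K) :
    ∑ i, topSize it K (it i) ≤ K := by
  classical
  rw [sum_topSize]
  have h0 : ∑ i ∈ top it K with 0 < (it i).size, (it i).size = ∑ i ∈ top it K, (it i).size :=
    sum_filter_of_ne fun i _ hi => lt_of_le_of_ne (hv i).2.1 (Ne.symm hi)
  rw [← h0]
  rcases (filter (fun i => 0 < (it i).size) (top it K)).eq_empty_or_nonempty with he | hne
  · rw [he]; simpa
  · obtain ⟨i, hi, hmin⟩ := exists_min_image _ (fun i => (it i).density) hne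
    have hi' := mem_filter.1 hi
    refine le_trans ?_ (mem_top.1 hi'.1)
    rw [load, if_pos hi'.2]
    refine sum_le_sum_of_subset_of_nonneg (fun j hj => ?_) fun j _ _ => (hv j).2.1
    simpa using hmin j hj

/-- The densest item outside the top: it separates the top from the rest. -/
theorem exists_separating (hv : ∀ i, (it i).Valid)
    (hd : ∀ i j, i ≠ j → 0 < (it i).size → 0 < (it j).size →
      (it i).density ≠ (it j).density) {K : ℝ} (hK : 0 ≤ K) (h : ∃ i, K < load it (it i)) :
    ∃ d : ℝ, 0 ≤ d ∧ (∀ i ∈ top it K, d * (it i).size ≤ (it i).value) ∧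
      (∀ i ∉ top it K, (it i).value ≤ d * (it i).size) ∧
      K - 1 < ∑ i ∈ top it K, (it i).size := by
  classical
  have hne : (univ.filter fun i => i ∉ top it K).Nonempty := by
    obtain ⟨i, hi⟩ := h
    exact ⟨i, by simpa [mem_top] using hi⟩
  obtain ⟨i, hi, hmax⟩ := exists_max_image _ (fun i => (it i).density) hne
  simp only [mem_filter, mem_univ, true_and] at hi hmax
  have hload : ∀ j ∉ top it K, K < load it (it j) := fun j hj => by
    simpa [mem_top] using hj
  have hpos : ∀ j ∉ top it K, 0 < (it j).size := fun j hj => size_pos_of_lt_load hK (hload j hj)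
  refine ⟨(it i).density, (hv i).density_nonneg, fun j hj => ?_, fun j hj => ?_, ?_⟩
  · rcases (hv j).2.1.eq_or_lt with h0 | h0
    · rw [← h0, mul_zero]; exact (hv j).1
    · rw [Item.value_eq_density_mul h0]
      refine mul_le_mul_of_nonneg_right ?_ h0.le
      by_contra hlt
      exact hi (mem_top.2 ((load_anti hv h0 (not_le.1 hlt).le).trans (mem_top.1 hj)))
  · rw [Item.value_eq_density_mul (hpos j hj)]
    exact mul_le_mul_of_nonneg_right (hmax j hj) (hpos j hj).le
  · have h1 := hload i hi
    rw [load, if_pos (hpos i hi)] at h1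
    -- Here distinct densities are essential: the load of i, which exceeds K, counts only i itself
    -- and items of the top. With ties, a large class of equal density could be left out as a whole.
    have h2 : ∑ j with (it i).density ≤ (it j).density, (it j).size
        ≤ ∑ j ∈ insert i (top it K), (it j).size := by
      refine sum_le_sum_of_subset_of_nonneg (fun j hj => ?_) fun j _ _ => (hv j).2.1
      rw [mem_insert]
      by_contra! hj'
      have hj2 : (it i).density ≤ (it j).density := by simpa using hj
      exact hd j i hj'.1 (hpos j hj'.2) (hpos i hi) (le_antisymm (hmax j hj'.2) hj2)
    rw [sum_insert hi] at h2
    have := (hv i).2.2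
    linarith

/-- The densest items of total size `K ≤ k` are worth at least a `(K - 1) / k` fraction of every
fractional solution of size `k`. -/
theorem mul_sum_value_le (hv : ∀ i, (it i).Valid)
    (hd : ∀ i j, i ≠ j → 0 < (it i).size → 0 < (it j).size →
      (it i).density ≠ (it j).density) {K k : ℝ} (hK : 0 ≤ K) (hKk : K ≤ k) {X : ι → ℝ}
    (hX : ∀ i, 0 ≤ X i ∧ X i ≤ 1) (hXk : ∑ i, (it i).size * X i ≤ k) :
    (K - 1) * ∑ i, (it i).value * X i ≤ k * ∑ i ∈ top it K, (it i).value := by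
  classical
  have hVX : 0 ≤ ∑ i, (it i).value * X i := sum_nonneg fun i _ => mul_nonneg (hv i).1 (hX i).1
  have hV : 0 ≤ ∑ i ∈ top it K, (it i).value := sum_nonneg fun i _ => (hv i).1
  rcases le_or_gt K 1 with hK1 | hK1
  · exact (mul_nonpos_of_nonpos_of_nonneg (by linarith) hVX).trans
      (mul_nonneg (hK.trans hKk) hV)
  by_cases hall : ∃ i, K < load it (it i)
  · obtain ⟨d, hd0, htop, hrest, hW⟩ := exists_separating hv hd hK hall
    have hWK := sum_topSize_le hv hK
    rw [sum_topSize] at hWK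
    set W := ∑ i ∈ top it K, (it i).size
    set V := ∑ i ∈ top it K, (it i).value
    have hVW : d * W ≤ V := by
      rw [mul_sum]; exact sum_le_sum htop
    -- Lagrangian duality: at the price d per unit of size, the top is the best choice.
    have h1 : ∑ i, (it i).value * X i - d * ∑ i, (it i).size * X i ≤ V - d * W := by
      rw [mul_sum, mul_sum, ← sum_sub_distrib, ← sum_sub_distrib,
        ← sum_filter_add_sum_filter_not univ (· ∈ top it K)]
      have e1 : univ.filter (· ∈ top it K) = top it K := by ext; simp
      rw [e1]
      have h2 : ∑ i ∈ top it K, ((it i).value * X i - d * ((it i).size * X i)) ≤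
          ∑ i ∈ top it K, ((it i).value - d * (it i).size) :=
        sum_le_sum fun i hi => by
          nlinarith [htop i hi, (hX i).2]
      have h3 : ∑ i with i ∉ top it K, ((it i).value * X i - d * ((it i).size * X i)) ≤ 0 :=
        sum_nonpos fun i hi => by
          nlinarith [hrest i (mem_filter.1 hi).2, (hX i).1]
      linarith
    have h4 : ∑ i, (it i).value * X i ≤ V + d * (k - W) := by
      nlinarith [mul_le_mul_of_nonneg_left hXk hd0]
    calc (K - 1) * ∑ i, (it i).value * X i ≤ W * ∑ i, (it i).value * X i :=
          mul_le_mul_of_nonneg_right hW.le hVX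
      _ ≤ W * (V + d * (k - W)) := mul_le_mul_of_nonneg_left h4 (by linarith)
      _ ≤ k * V := by nlinarith [mul_le_mul_of_nonneg_right hVW (by linarith : 0 ≤ k - W)]
  · push Not at hall
    have : top it K = univ := by ext i; simp [mem_top, hall i]
    rw [this]
    have h1 : ∑ i, (it i).value * X i ≤ ∑ i, (it i).value :=
      sum_le_sum fun i _ => mul_le_of_le_one_right (hv i).1 (hX i).2
    nlinarith

end Density

/-! ### Exchange arguments for the linear program -/

section LinearProgram

variable {n ℓ : ℕ} {k Γ : ℝ} {x : Fin n → Item} {t : Fin n} {X : Fin n → ℝ}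

theorem sum_mul_perturb (F : Finset (Fin n)) (u X : Fin n → ℝ) (s r : Fin n) (a b : ℝ) :
    ∑ q ∈ F, u q * (X q + (if q = s then a else 0) - (if q = r then b else 0)) =
      ∑ q ∈ F, u q * X q + (if s ∈ F then u s * a else 0) - (if r ∈ F then u r * b else 0) := by
  have h : ∀ q, u q * (X q + (if q = s then a else 0) - (if q = r then b else 0)) =
      u q * X q + (if q = s then u s * a else 0) - (if q = r then u r * b else 0) := fun q => by
    by_cases h1 : q = s <;> by_cases h2 : q = r <;> simp_all <;> ring
  rw [sum_congr rfl fun q _ => h q, sum_sub_distrib, sum_add_distrib, sum_ite_eq', sum_ite_eq']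

/-- No feasible exchange of `b` units of `r` for `a` units of `s` improves an optimal solution. -/
theorem LPOptimal.value_mul_le (hX : LPOptimal ℓ k Γ x t X) (hx : ∀ s, (x s).Valid) {s r : Fin n}
    (hs : s ≤ t) (hr : r ≤ t) {a b : ℝ} (ha : 0 ≤ a) (hb : 0 ≤ b) (hsa : X s + a ≤ 1)
    (hrb : b ≤ X r)
    (hbudget : ∑ q ∈ Iic t, (x q).size * X q + (x s).size * a - (x r).size * b ≤
      (1 - 4 * Γ * ℓ / ((t : ℝ) + 1)) * (((t : ℝ) + 1) / n) * k)
    (hinner : ∑ q ∈ Iic t with window ℓ q = window ℓ s, (x q).size * X q + (x s).size * a -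
      (if window ℓ r = window ℓ s then (x r).size * b else 0) ≤ 601 * (ℓ / n) * k) :
    (x s).value * a ≤ (x r).value * b := by
  obtain ⟨hf, hopt⟩ := hX
  have hY : LPFeasible ℓ k Γ x t
      (fun q => X q + (if q = s then a else 0) - (if q = r then b else 0)) := by
    refine ⟨fun q => ?_, fun q => ?_, fun q hq => ?_, ?_, fun j => ?_⟩
    · have := hf.nonneg q
      by_cases h1 : q = s <;> by_cases h2 : q = r <;> simp_all <;> linarith
    · have := hf.le_one q
      by_cases h1 : q = s <;> by_cases h2 : q = r <;> simp_all <;> linarith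
    · rw [hf.future q hq, if_neg (hs.trans_lt hq).ne', if_neg (hr.trans_lt hq).ne']
      simp
    · rw [sum_mul_perturb, if_pos (mem_Iic.2 hs), if_pos (mem_Iic.2 hr)]
      exact hbudget
    · rw [sum_mul_perturb]
      simp only [mem_filter, mem_Iic, hs, hr, true_and]
      by_cases hj : window ℓ s = j
      · subst hj
        rw [if_pos rfl]
        exact hinner
      · rw [if_neg hj]
        -- In every window other than that of s, the exchange can only remove size.
        have h1 := hf.inner j
        have h2 : 0 ≤ (if window ℓ r = j then (x r).size * b else 0) := by
          split_ifs
          · exact mul_nonneg (hx r).2.1 hb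
          · exact le_rfl
        linarith
  have := hopt _ hY
  rw [sum_mul_perturb, if_pos (mem_Iic.2 hs), if_pos (mem_Iic.2 hr)] at this
  linarith

/-- An item that is used is at least as dense as any item that is not fully used, if the latter
belongs to the same window or to a window with room left. -/
theorem LPOptimal.density_le (hX : LPOptimal ℓ k Γ x t X) (hx : ∀ s, (x s).Valid) {s r : Fin n}
    (hs : s ≤ t) (hr : r ≤ t) (hws : 0 < (x s).size) (hwr : 0 < (x r).size) (hXs : X s < 1)
    (hXr : 0 < X r)
    (h : window ℓ r = window ℓ s ∨
      ∑ q ∈ Iic t with window ℓ q = window ℓ s, (x q).size * X q < 601 * (ℓ / n) * k) :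
    (x s).density ≤ (x r).density := by
  -- δ is the size that changes hands. Equal sizes are exchanged, so the budget is unaffected, and
  -- so is the window constraint if s and r share a window.
  obtain ⟨δ, hδ, h1, h2, h3⟩ : ∃ δ : ℝ, 0 < δ ∧ δ ≤ (1 - X s) * (x s).size ∧
      δ ≤ X r * (x r).size ∧ (window ℓ r = window ℓ s ∨
        ∑ q ∈ Iic t with window ℓ q = window ℓ s, (x q).size * X q + δ ≤ 601 * (ℓ / n) * k) := by
    have p1 : 0 < (1 - X s) * (x s).size := mul_pos (by linarith) hws
    have p2 : 0 < X r * (x r).size := mul_pos hXr hwr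
    rcases h with h | h
    · exact ⟨min ((1 - X s) * (x s).size) (X r * (x r).size), lt_min p1 p2, min_le_left _ _,
        min_le_right _ _, Or.inl h⟩
    · refine ⟨min (min ((1 - X s) * (x s).size) (X r * (x r).size)) (601 * (ℓ / n) * k -
        ∑ q ∈ Iic t with window ℓ q = window ℓ s, (x q).size * X q),
        lt_min (lt_min p1 p2) (sub_pos.2 h), (min_le_left _ _).trans (min_le_left _ _),
        (min_le_left _ _).trans (min_le_right _ _), Or.inr ?_⟩
      have := min_le_right (min ((1 - X s) * (x s).size) (X r * (x r).size)) (601 * (ℓ / n) * k -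
        ∑ q ∈ Iic t with window ℓ q = window ℓ s, (x q).size * X q)
      linarith
  have es : (x s).size * (δ / (x s).size) = δ := mul_div_cancel₀ _ hws.ne'
  have er : (x r).size * (δ / (x r).size) = δ := mul_div_cancel₀ _ hwr.ne'
  have key := hX.value_mul_le hx hs hr (a := δ / (x s).size) (b := δ / (x r).size)
    (by positivity) (by positivity) (by have := (div_le_iff₀ hws).2 h1; linarith)
    ((div_le_iff₀ hwr).2 h2)
    (by rw [es, er, add_sub_cancel_right]; exact hX.1.budget)
    (by
      rw [es, er]
      rcases h3 with h3 | h3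
      · rw [if_pos h3, add_sub_cancel_right]; exact hX.1.inner _
      · split_ifs <;> linarith)
  rw [Item.density, Item.density]
  have e1 : (x s).value * (δ / (x s).size) = (x s).value / (x s).size * δ := by ring
  have e2 : (x r).value * (δ / (x r).size) = (x r).value / (x r).size * δ := by ring
  rw [e1, e2] at key
  exact le_of_mul_le_mul_right key hδ

/-- A valuable item that is not fully used is blocked by a tight constraint. -/
theorem LPOptimal.tight (hX : LPOptimal ℓ k Γ x t X) (hx : ∀ s, (x s).Valid) {s : Fin n}
    (hs : s ≤ t) (hv : 0 < (x s).value) (hXs : X s < 1) :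
    0 < (x s).size ∧
      ((1 - 4 * Γ * ℓ / ((t : ℝ) + 1)) * (((t : ℝ) + 1) / n) * k ≤
        ∑ q ∈ Iic t, (x q).size * X q ∨
      601 * (ℓ / n) * k ≤ ∑ q ∈ Iic t with window ℓ q = window ℓ s, (x q).size * X q) := by
  by_contra hcon
  obtain ⟨a, ha, h1, h2, h3⟩ : ∃ a : ℝ, 0 < a ∧ X s + a ≤ 1 ∧
      ∑ q ∈ Iic t, (x q).size * X q + (x s).size * a ≤
        (1 - 4 * Γ * ℓ / ((t : ℝ) + 1)) * (((t : ℝ) + 1) / n) * k ∧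
      ∑ q ∈ Iic t with window ℓ q = window ℓ s, (x q).size * X q + (x s).size * a ≤
        601 * (ℓ / n) * k := by
    rcases (hx s).2.1.eq_or_lt with h0 | h0
    · refine ⟨1 - X s, by linarith, by linarith, ?_, ?_⟩
      · rw [← h0]; simpa using hX.1.budget
      · rw [← h0]; simpa using hX.1.inner _
    · rw [not_and_or, not_or, not_le, not_le] at hcon
      obtain ⟨hc1, hc2⟩ := hcon.resolve_left (not_not.2 h0)
      have p1 := sub_pos.2 hc1
      have p2 := sub_pos.2 hc2
      refine ⟨min (1 - X s) (min _ _), lt_min (by linarith) (lt_min p1 p2), ?_, ?_, ?_⟩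
      · have := min_le_left (1 - X s) (min ((1 - 4 * Γ * ℓ / ((t : ℝ) + 1)) * (((t : ℝ) + 1) / n) * k
          - ∑ q ∈ Iic t, (x q).size * X q) (601 * (ℓ / n) * k -
          ∑ q ∈ Iic t with window ℓ q = window ℓ s, (x q).size * X q))
        linarith
      · have h4 := (min_le_right (1 - X s) (min ((1 - 4 * Γ * ℓ / ((t : ℝ) + 1)) *
          (((t : ℝ) + 1) / n) * k - ∑ q ∈ Iic t, (x q).size * X q) (601 * (ℓ / n) * k -
          ∑ q ∈ Iic t with window ℓ q = window ℓ s, (x q).size * X q))).trans (min_le_left _ _)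
        have := mul_le_mul (hx s).2.2 h4 (le_min (by linarith) (le_min p1.le p2.le)) zero_le_one
        linarith
      · have h4 := (min_le_right (1 - X s) (min ((1 - 4 * Γ * ℓ / ((t : ℝ) + 1)) *
          (((t : ℝ) + 1) / n) * k - ∑ q ∈ Iic t, (x q).size * X q) (601 * (ℓ / n) * k -
          ∑ q ∈ Iic t with window ℓ q = window ℓ s, (x q).size * X q))).trans (min_le_right _ _)
        have := mul_le_mul (hx s).2.2 h4 (le_min (by linarith) (le_min p1.le p2.le)) zero_le_one
        linarith
  -- Exchanging zero units is a pure increase of s, which would improve the optimum.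
  have := hX.value_mul_le hx hs hs ha.le le_rfl h1 (hX.1.nonneg s) (by simpa using h2)
    (by simpa using h3)
  nlinarith [mul_pos hv ha]

/-- If the items of density at least `d` overfill a window, only such items are used there. -/
theorem LPOptimal.inner_lt (hX : LPOptimal ℓ k Γ x t X) (hx : ∀ s, (x s).Valid) {s : Fin n}
    (hs : s ≤ t) (hws : 0 < (x s).size) (hXs : X s < 1) (φ : Item → ℝ)
    (hφ0 : ∀ q, 0 ≤ φ (x q))
    (hφ : ∀ q, (x s).density ≤ (x q).density → 0 < (x q).size → φ (x q) = (x q).size)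
    (hsum : ∑ q with window ℓ q = window ℓ s, φ (x q) < 601 * (ℓ / n) * k) :
    ∑ q ∈ Iic t with window ℓ q = window ℓ s, (x q).size * X q < 601 * (ℓ / n) * k := by
  refine lt_of_le_of_lt ?_ hsum
  refine (sum_le_sum fun q hq => ?_).trans
    (sum_le_sum_of_subset_of_nonneg (filter_subset_filter _ (subset_univ _)) fun q _ _ => hφ0 q)
  obtain ⟨hqt, hqw⟩ := mem_filter.1 hq
  rcases (hx q).2.1.eq_or_lt with h0 | h0
  · rw [← h0, zero_mul]; exact hφ0 q
  rcases (hX.1.nonneg q).eq_or_lt with h1 | h1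
  · rw [← h1, mul_zero]; exact hφ0 q
  -- A used item q in the window of s is at least as dense as s, because s is not full; hence φ
  -- counts the full size of q.
  rw [hφ q (hX.density_le hx hs (mem_Iic.1 hqt) hws h0 hXs h1 (Or.inl hqw)) h0]
  exact mul_le_of_le_one_right h0.le (hX.1.le_one q)

end LinearProgram

/-! ### The behaviour of the algorithm on typical arrival orders -/

/-! ### Counting times by windows -/

section Counting

variable {n ℓ : ℕ}

theorem card_window_le (hℓ : 0 < ℓ) (j : ℕ) : #{s : Fin n | window ℓ s = j} ≤ ℓ := by
  have : #{s : Fin n | window ℓ s = j} ≤ #(Finset.Ico (j * ℓ) (j * ℓ + ℓ)) := by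
    refine card_le_card_of_injOn (fun s => (s : ℕ)) (fun s hs => ?_) fun s _ r _ h => Fin.ext h
    have hs' : (s : ℕ) / ℓ = j := (mem_filter.1 (mem_coe.1 hs)).2
    subst hs'
    have h1 := Nat.div_add_mod (s : ℕ) ℓ
    have h2 := Nat.mod_lt (s : ℕ) hℓ
    simp only [coe_Ico, Set.mem_Ico]
    rw [mul_comm]
    omega
  simpa using this

theorem card_covered_le (hℓ : 0 < ℓ) (cover : Finset ℕ) :
    #{s : Fin n | window ℓ s ∈ cover} ≤ cover.card * ℓ := by
  rw [mul_comm]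
  refine card_le_mul_card_image_of_maps_to (f := fun s : Fin n => window ℓ s)
    (fun s hs => (mem_filter.1 hs).2) ℓ fun j _ => ?_
  exact (card_le_card (filter_subset_filter _ (subset_univ _))).trans (card_window_le hℓ j)

theorem card_uncovered_prefix_ge (hℓ : 0 < ℓ) (cover : Finset ℕ) {i : ℕ} (hi : i ≤ n) :
    (i : ℝ) - cover.card * ℓ ≤ #{s : Fin n | window ℓ s ∉ cover ∧ (s : ℕ) < i} := by
  have h1 : #{s : Fin n | (s : ℕ) < i} = i := by
    rw [Fin.card_filter_val_lt, min_eq_right hi]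
  have h2 : #{s : Fin n | (s : ℕ) < i} ≤ #{s : Fin n | window ℓ s ∈ cover} +
      #{s : Fin n | window ℓ s ∉ cover ∧ (s : ℕ) < i} := by
    refine (card_le_card fun s hs => ?_).trans (card_union_le _ _)
    simp only [mem_filter, mem_univ, true_and, mem_union] at hs ⊢
    tauto
  have h3 := card_covered_le (n := n) hℓ cover
  have h4 : i ≤ cover.card * ℓ + #{s : Fin n | window ℓ s ∉ cover ∧ (s : ℕ) < i} := by omega
  have : (i : ℝ) ≤ cover.card * ℓ + #{s : Fin n | window ℓ s ∉ cover ∧ (s : ℕ) < i} := by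
    exact_mod_cast h4
  linarith

theorem card_uncovered_prefix_le (cover : Finset ℕ) (i : ℕ) :
    #{s : Fin n | window ℓ s ∉ cover ∧ (s : ℕ) < i} ≤ i := by
  have : #{s : Fin n | (s : ℕ) < i} ≤ i := by
    rw [Fin.card_filter_val_lt]; exact min_le_right _ _
  refine (card_le_card fun s hs => ?_).trans this
  simp only [mem_filter, mem_univ, true_and] at hs ⊢
  exact hs.2

end Counting

/-- The size of the densest items of total size `K` that arrive before step `i` and outside the
covered windows. -/
def prefixSize {n m : ℕ} (ℓ : ℕ) (it : Fin m → Item) (cover : Finset ℕ) (K : ℝ)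
    (x : Fin n → Item) (i : ℕ) : ℝ :=
  ∑ s : Fin n with window ℓ s ∉ cover ∧ (s : ℕ) < i, topSize it K (x s)

/-- The expectation of `prefixSize`. -/
def prefixMean {m : ℕ} (n ℓ : ℕ) (it : Fin m → Item) (cover : Finset ℕ) (K : ℝ) (i : ℕ) : ℝ :=
  #{s : Fin n | window ℓ s ∉ cover ∧ (s : ℕ) < i} * (𝔼 j, topSize it K (it j))

/-- The ranges of the parameters, with `m` random-order items. -/
structure Regime (n ℓ m : ℕ) (k Γ : ℝ) : Prop where
  k_ge : 80 ≤ k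
  k_le : k ≤ (n : ℝ) / 2
  ell_pos : 0 < ℓ
  unit_ge : 1 ≤ (ℓ : ℝ) / n * k
  Γ_ge : 1 ≤ Γ
  burst_le : Γ * ℓ / n ≤ 1 / 2
  m_le : m ≤ n
  le_m : (n : ℝ) ≤ m + Γ * ℓ
  le_sq : k ≤ Γ ^ 2
  log_le : Real.log k ≤ (ℓ : ℝ) / n * k + 1 / 2

namespace Regime

variable {n ℓ m : ℕ} {k Γ : ℝ} (R : Regime n ℓ m k Γ)
include R

theorem n_pos : (0 : ℝ) < n := by linarith [R.k_ge, R.k_le]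

theorem n_le_two_mul : (n : ℝ) ≤ 2 * m := by
  have h1 := R.le_m
  have h2 := R.burst_le
  rw [div_le_iff₀ R.n_pos] at h2
  linarith

theorem m_pos : (0 : ℝ) < m := by linarith [R.n_le_two_mul, R.n_pos]

theorem unit_le : (ℓ : ℝ) / n * k ≤ Γ * (ℓ / n * k) :=
  le_mul_of_one_le_left (zero_le_one.trans R.unit_ge) R.Γ_ge

theorem log_ge : 1 / 2 ≤ Real.log (n / (Γ * ℓ)) := by
  have hℓ : (0 : ℝ) < ℓ := by exact_mod_cast R.ell_pos
  have hb : 0 < Γ * ℓ := mul_pos (by linarith [R.Γ_ge]) hℓ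
  have hburst := R.burst_le
  rw [div_le_iff₀ R.n_pos] at hburst
  have h1 : (2 : ℝ) ≤ n / (Γ * ℓ) := by
    rw [le_div_iff₀ hb]; linarith
  have h2 := Real.log_le_log (by norm_num) h1
  linarith [Real.log_two_gt_d9]

/-- Lets every loss of order 1/k be absorbed into the main error term. -/
theorem inv_le : 1 / k ≤ Γ * ℓ / n := by
  rw [div_le_div_iff₀ (by linarith [R.k_ge]) R.n_pos]
  have h1 := R.unit_ge.trans R.unit_le
  have h2 : Γ * ((ℓ : ℝ) / n * k) = Γ * ℓ * k / n := by ring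
  rw [h2, le_div_iff₀ R.n_pos] at h1
  exact h1

theorem budget_eq (t : Fin n) :
    (1 - 4 * Γ * ℓ / ((t : ℝ) + 1)) * (((t : ℝ) + 1) / n) * k =
      ((t : ℝ) + 1) / n * k - 4 * (Γ * (ℓ / n * k)) := by
  have h1 : (t : ℝ) + 1 ≠ 0 := by positivity
  have h2 := R.n_pos.ne'
  field_simp

/-- The difference i/m - i/n is at most (n - m)/m, where n - m ≤ Γℓ and m ≥ n/2. This is the price
of drawing from m items rather than n. -/
theorem div_card_le {i : ℝ} (hi : i ≤ n) : i / m ≤ i / n + 2 * (Γ * (ℓ / n)) := by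
  have h1 := R.m_pos
  have h2 := R.n_pos
  have h3 : i / n + 2 * (Γ * (ℓ / n)) = (i + 2 * (Γ * ℓ)) / n := by field_simp
  rw [h3, div_le_div_iff₀ h1 h2]
  have hΓ : 0 ≤ Γ * ℓ := mul_nonneg (by linarith [R.Γ_ge]) (Nat.cast_nonneg _)
  have hm : (m : ℝ) ≤ n := by exact_mod_cast R.m_le
  nlinarith [mul_le_mul_of_nonneg_left R.n_le_two_mul hΓ, R.le_m,
    mul_le_mul_of_nonneg_right hi (sub_nonneg.2 hm)]

theorem prefixMean_le {it : Fin m → Item} (hv : ∀ i, (it i).Valid) (cover : Finset ℕ) {K : ℝ}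
    (hK : 0 ≤ K) {i : ℕ} (hi : i ≤ n) :
    prefixMean n ℓ it cover K i ≤ (i / n + 2 * (Γ * (ℓ / n))) * K := by
  rw [prefixMean, Fintype.expect_eq_sum_div_card, Fintype.card_fin]
  have h1 : (#{s : Fin n | window ℓ s ∉ cover ∧ (s : ℕ) < i} : ℝ) ≤ i := by
    exact_mod_cast card_uncovered_prefix_le cover i
  have h2 := sum_topSize_le hv hK
  have h3 : (0 : ℝ) ≤ ∑ j, topSize it K (it j) := sum_nonneg fun j _ => topSize_nonneg (hv j) K
  have h4 := R.div_card_le (i := i) (by exact_mod_cast hi)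
  calc _ ≤ (i : ℝ) * (K / m) := by
        refine mul_le_mul h1 ?_ (div_nonneg h3 R.m_pos.le) (Nat.cast_nonneg _)
        exact div_le_div_of_nonneg_right h2 R.m_pos.le
    _ = i / m * K := by ring
    _ ≤ _ := mul_le_mul_of_nonneg_right h4 hK

end Regime

/-- The typical behaviour of an arrival order: in all windows and prefixes the amount of top items
is close to its expectation. -/
structure Typical {n m : ℕ} (ℓ : ℕ) (k Γ : ℝ) (it : Fin m → Item) (cover : Finset ℕ)
    (x : Fin n → Item) : Prop where
  inner : ∀ j ∈ range (n / ℓ + 1), j ∉ cover →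
    ∑ q with window ℓ q = j, topSize it (k + 1) (x q) ≤ 600 * (ℓ / n * k)
  lower : ∀ j ∈ range (n / ℓ + 1), prefixMean n ℓ it cover (k + 1) (j * ℓ) - Γ * (ℓ / n * k) ≤
    prefixSize ℓ it cover (k + 1) x (j * ℓ)

/-! ### Tentative picks on typical orders -/

section Deterministic

variable {n ℓ m : ℕ} {k Γ : ℝ} {it : Fin m → Item} {cover : Finset ℕ} {x : Fin n → Item}
  {t : Fin n} {X : Fin n → ℝ}

theorem window_mem_range (t : Fin n) : window ℓ t ∈ range (n / ℓ + 1) :=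
  mem_range.2 (Nat.lt_succ_of_le (Nat.div_le_div_right t.isLt.le))

/-- On typical arrival orders only the densest items are tentatively picked. -/
theorem Typical.load_le (R : Regime n ℓ m k Γ) (hT : Typical ℓ k Γ it cover x)
    (hv : ∀ i, (it i).Valid) (hx : ∀ s, (x s).Valid) (hc : (cover.card : ℝ) ≤ Γ)
    (hW : k + 1 < load it (x t) → k < ∑ i, topSize it (k + 1) (it i))
    (hX : LPOptimal ℓ k Γ x t X) (hXt : 0 < X t) : load it (x t) ≤ k + 1 := by
  have hk := R.k_ge
  have hk1 : 0 ≤ k + 1 := by linarith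
  have hn := R.n_pos
  by_contra! hload
  have hwt := size_pos_of_lt_load hk1 hload
  -- An uncovered top item that is not full could be exchanged for the less dense item at t, since
  -- its window has room: items at least as dense as it use at most 600L < 601L there.
  have hone : ∀ s ≤ t, window ℓ s ∉ cover → load it (x s) ≤ k + 1 → 0 < (x s).size →
      X s = 1 := by
    intro s hs hsc hls hws
    by_contra hne
    have hlt : X s < 1 := lt_of_le_of_ne (hX.1.le_one s) hne
    have hin := hX.inner_lt hx hs hws hlt (topSize it (k + 1)) (fun q => topSize_nonneg (hx q) _)
      (fun q hq _ => by rw [topSize, if_pos ((load_anti hv hws hq).trans hls)])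
      (lt_of_le_of_lt (hT.inner _ (window_mem_range s) hsc) (by linarith [R.unit_ge]))
    have := hX.density_le hx hs le_rfl hws hwt hlt hXt (Or.inr hin)
    exact absurd ((load_anti hv hws this).trans hls) hload.not_ge
  have hbud := hX.1.budget
  rw [R.budget_eq] at hbud
  -- `Typical` controls prefixes at window boundaries only; cutting at the start of the window of t
  -- loses at most ℓ steps.
  set j := window ℓ t with hj
  have hjt : j * ℓ ≤ t := Nat.div_mul_le_self _ _
  have hjt' : (t : ℕ) + 1 ≤ j * ℓ + ℓ := by
    have h1 := Nat.div_add_mod (t : ℕ) ℓ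
    have h2 := Nat.mod_lt (t : ℕ) R.ell_pos
    rw [hj, window, mul_comm]
    omega
  have hlow := hT.lower j (window_mem_range t)
  have hpre : prefixSize ℓ it cover (k + 1) x (j * ℓ) ≤ ∑ s ∈ Iic t, (x s).size * X s := by
    rw [prefixSize]
    refine (sum_le_sum (g := fun s => (x s).size * X s) fun s hs => ?_).trans
      (sum_le_sum_of_subset_of_nonneg (fun s hs => ?_) fun s _ _ =>
        mul_nonneg (hx s).2.1 (hX.1.nonneg s))
    · obtain ⟨hsc, hsj⟩ := (mem_filter.1 hs).2
      have hst : s ≤ t := Fin.le_def.2 (hsj.le.trans hjt)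
      unfold topSize
      split_ifs with hls
      · rcases (hx s).2.1.eq_or_lt with h0 | h0
        · rw [← h0, zero_mul]
        · rw [hone s hst hsc hls h0, mul_one]
      · exact mul_nonneg (hx s).2.1 (hX.1.nonneg s)
    · obtain ⟨hsc, hsj⟩ := (mem_filter.1 hs).2
      exact mem_Iic.2 (Fin.le_def.2 (hsj.le.trans hjt))
  have hmean : ((t : ℝ) + 1 - ℓ - Γ * ℓ) / n * k ≤ prefixMean n ℓ it cover (k + 1) (j * ℓ) := by
    rw [prefixMean, Fintype.expect_eq_sum_div_card, Fintype.card_fin]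
    have h1 := card_uncovered_prefix_ge R.ell_pos cover (i := j * ℓ) (hjt.trans t.isLt.le)
    set c : ℝ := (#{s : Fin n | window ℓ s ∉ cover ∧ (s : ℕ) < j * ℓ} : ℝ)
    have hc0 : 0 ≤ c := Nat.cast_nonneg _
    have h2 : (t : ℝ) + 1 ≤ ((j * ℓ : ℕ) : ℝ) + ℓ := by exact_mod_cast hjt'
    have h3 := mul_le_mul_of_nonneg_right hc (Nat.cast_nonneg (α := ℝ) ℓ)
    have hm : (m : ℝ) ≤ n := by exact_mod_cast R.m_le
    calc ((t : ℝ) + 1 - ℓ - Γ * ℓ) / n * k ≤ c / n * k := by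
          gcongr
          linarith
      _ = c * (k / n) := by ring
      _ ≤ c * (k / m) := by
          refine mul_le_mul_of_nonneg_left ?_ hc0
          exact div_le_div_of_nonneg_left (by linarith) R.m_pos hm
      _ ≤ _ := by
          refine mul_le_mul_of_nonneg_left ?_ hc0
          exact div_le_div_of_nonneg_right (hW hload).le R.m_pos.le
  -- The top items use at least (t + 1)k/n - L - 2ΓL. As L ≤ ΓL, this exceeds the budget (t + 1)k/n
  -- - 4ΓL by at least ΓL.
  have he : ((t : ℝ) + 1 - ℓ - Γ * ℓ) / n * k =
      ((t : ℝ) + 1) / n * k - ℓ / n * k - Γ * (ℓ / n * k) := by ring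
  have h1 := R.unit_le
  have h2 := R.unit_ge
  have h3 := R.Γ_ge
  nlinarith

/-- Sufficiently dense items that arrive outside the covered windows are tentatively picked. -/
theorem Typical.pos_of_load_le (R : Regime n ℓ m k Γ) (hT : Typical ℓ k Γ it cover x)
    (hv : ∀ i, (it i).Valid) (hx : ∀ s, (x s).Valid) (hc : (cover.card : ℝ) ≤ Γ)
    (ht : window ℓ t ∉ cover) {K : ℝ} (hK : 0 ≤ K)
    (hKt : K * ((t : ℝ) + 1) ≤ k * ((t : ℝ) + 1 - 609 * (Γ * ℓ)))
    (hup : prefixSize ℓ it cover K x (t + 1) ≤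
      prefixMean n ℓ it cover K (t + 1) + Γ * (ℓ / n * k))
    (hload : load it (x t) ≤ K) (hval : 0 < (x t).value)
    (hX : LPOptimal ℓ k Γ x t X) : 0 < X t := by
  have hk := R.k_ge
  have hn := R.n_pos
  by_contra hneg
  have hX0 : X t < 1 := by linarith
  have hΓℓ : 0 ≤ Γ * (ℓ : ℝ) := mul_nonneg (by linarith [R.Γ_ge]) (Nat.cast_nonneg _)
  have hKk : K ≤ k := by
    have : (0 : ℝ) < (t : ℝ) + 1 := by positivity
    nlinarith
  obtain ⟨hwt, htight⟩ := hX.tight hx le_rfl hval hX0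
  have hin := hX.inner_lt hx le_rfl hwt hX0 (topSize it (k + 1)) (fun q => topSize_nonneg (hx q) _)
      (fun q hq _ => by
        rw [topSize, if_pos ((load_anti hv hwt hq).trans (hload.trans (by linarith)))])
      (lt_of_le_of_lt (hT.inner _ (window_mem_range t) ht) (by linarith [R.unit_ge]))
  have hbud := htight.resolve_right hin.not_ge
  rw [R.budget_eq] at hbud
  -- The item at t is unused and its window has room, so every used item is at least as dense and
  -- has load at most K.
  have hused : ∀ s ∈ Iic t, (x s).size * X s ≤ topSize it K (x s) := fun s hs => by
    rcases (hx s).2.1.eq_or_lt with h0 | h0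
    · rw [← h0, zero_mul]; exact topSize_nonneg (hx s) K
    rcases (hX.1.nonneg s).eq_or_lt with h1 | h1
    · rw [← h1, mul_zero]; exact topSize_nonneg (hx s) K
    have hd := hX.density_le hx le_rfl (mem_Iic.1 hs) hwt h0 hX0 h1 (Or.inr hin)
    rw [topSize, if_pos ((load_anti hv hwt hd).trans hload)]
    exact mul_le_of_le_one_right h0.le (hX.1.le_one s)
  -- The inner constraints limit the adversary, whose items obey no concentration bound.
  have hcov : ∑ s ∈ Iic t with window ℓ s ∈ cover, (x s).size * X s ≤
      Γ * (601 * (ℓ / n * k)) := by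
    have h1 : ∑ s ∈ Iic t with window ℓ s ∈ cover, (x s).size * X s =
        ∑ j ∈ cover, ∑ s ∈ Iic t with window ℓ s = j, (x s).size * X s := by
      rw [← sum_fiberwise_of_maps_to (t := cover) (g := fun s => window ℓ s)
        (fun s hs => (mem_filter.1 hs).2)]
      refine sum_congr rfl fun j hj => sum_congr ?_ fun _ _ => rfl
      ext s
      simp only [mem_filter]
      constructor
      · rintro ⟨⟨h1, _⟩, h2⟩; exact ⟨h1, h2⟩
      · rintro ⟨h1, h2⟩; exact ⟨⟨h1, h2 ▸ hj⟩, h2⟩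
    rw [h1]
    refine (sum_le_sum fun j _ => hX.1.inner j).trans ?_
    rw [sum_const, nsmul_eq_mul, mul_assoc (601 : ℝ)]
    exact mul_le_mul_of_nonneg_right hc (by linarith [R.unit_ge])
  have hfree : ∑ s ∈ Iic t with window ℓ s ∉ cover, (x s).size * X s ≤
      prefixSize ℓ it cover K x (t + 1) := by
    rw [prefixSize]
    have : (Iic t).filter (fun s => window ℓ s ∉ cover) =
        univ.filter fun s : Fin n => window ℓ s ∉ cover ∧ (s : ℕ) < t + 1 := by
      ext s
      simp only [mem_filter, mem_Iic, mem_univ, true_and, Nat.lt_succ_iff, Fin.le_def]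
      tauto
    rw [← this]
    exact sum_le_sum fun s hs => hused s (mem_filter.1 hs).1
  have hsplit := sum_filter_add_sum_filter_not (Iic t) (fun s => window ℓ s ∈ cover)
    fun s => (x s).size * X s
  have hmean := R.prefixMean_le hv cover hK (i := t + 1) t.isLt
  push_cast at hmean
  have h1 : (((t : ℝ) + 1) / n + 2 * (Γ * (ℓ / n))) * K ≤
      ((t : ℝ) + 1) / n * k - 607 * (Γ * (ℓ / n * k)) := by
    have e1 : (((t : ℝ) + 1) / n + 2 * (Γ * (ℓ / n))) * K =
        (K * ((t : ℝ) + 1) + 2 * (Γ * ℓ) * K) / n := by ring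
    have e2 : ((t : ℝ) + 1) / n * k - 607 * (Γ * (ℓ / n * k)) =
        (k * ((t : ℝ) + 1) - 607 * (Γ * ℓ) * k) / n := by ring
    rw [e1, e2]
    refine div_le_div_of_nonneg_right ?_ hn.le
    nlinarith [mul_le_mul_of_nonneg_left hKk hΓℓ]
  -- After 2 of the 609 units have paid for the mean, 607ΓL remain, more than 601ΓL for the covered
  -- windows, ΓL for the deviation and 4ΓL for the lowered budget. So the budget cannot be tight.
  have h2 := R.unit_le
  have h3 := R.unit_ge
  have e3 : Γ * (601 * (ℓ / n * k)) = 601 * (Γ * ((ℓ : ℝ) / n * k)) := by ring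
  linarith

end Deterministic

/-! ### From tentative picks to actual selections -/

section Acceptance

variable {n ℓ : ℕ} {k Γ : ℝ} {a₄ : ℝ} {S : LPSolver n ℓ k Γ} {x : Fin n → Item}

theorem tentative_of_mem_primalSelect {i : ℕ} {s : Fin n} (hs : s ∈ primalSelect a₄ S x i) :
    Tentative S x s := by
  induction i with
  | zero => simp [primalSelect] at hs
  | succ i ih =>
    rw [primalSelect] at hs
    split_ifs at hs with h h'
    · rcases mem_insert.1 hs with rfl | hs
      · exact h'.1
      · exact ih hs
    · exact ih hs
    · exact ih hs

theorem sum_primalSelect_le (hk : 0 ≤ k) (hx : ∀ s, (x s).Valid) (i : ℕ) :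
    ∑ s ∈ primalSelect a₄ S x i, (x s).size ≤ k := by
  induction i with
  | zero => simpa [primalSelect]
  | succ i ih =>
    rw [primalSelect]
    split_ifs with h h'
    · rw [sum_insert fun hm => (lt_of_mem_primalSelect a₄ S x i _ hm).false]
      linarith [h'.2.1, (hx ⟨i, h⟩).2.2]
    · exact ih
    · exact ih

theorem sum_window_primalSelect_le (ha : 0 ≤ a₄ * (ℓ / n) * k) (hx : ∀ s, (x s).Valid) (i j : ℕ) :
    ∑ s ∈ primalSelect a₄ S x i with window ℓ s = j, (x s).size ≤ a₄ * (ℓ / n) * k := by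
  induction i with
  | zero => simpa [primalSelect]
  | succ i ih =>
    rw [primalSelect]
    split_ifs with h h'
    · rw [filter_insert]
      split_ifs with hj
      · rw [sum_insert fun hm =>
          (lt_of_mem_primalSelect a₄ S x i _ (mem_filter.1 hm).1).false]
        have := h'.2.2
        rw [hj] at this
        linarith [(hx ⟨i, h⟩).2.2]
      · exact ih
    · exact ih
    · exact ih

theorem primalAlg_feasible (hk : 0 ≤ k) : (primalAlg a₄ S).Feasible k :=
  fun _ hx => sum_primalSelect_le hk hx n

theorem zero_lpFeasible {m : ℕ} (R : Regime n ℓ m k Γ) {t : Fin n}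
    (ht : 4 * (Γ * ℓ) ≤ (t : ℝ) + 1) : LPFeasible ℓ k Γ x t 0 where
  nonneg _ := le_rfl
  le_one _ := zero_le_one
  future _ _ := rfl
  budget := by
    rw [R.budget_eq]
    have e : ((t : ℝ) + 1) / n * k - 4 * (Γ * (ℓ / n * k)) =
      ((t : ℝ) + 1 - 4 * (Γ * ℓ)) * (k / n) := by ring
    rw [e]
    simpa using mul_nonneg (sub_nonneg.2 ht) (div_nonneg (by linarith [R.k_ge]) R.n_pos.le)
  inner _ := by
    have := R.unit_ge
    simp only [Pi.zero_apply, mul_zero, sum_const_zero]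
    linarith

variable {m : ℕ} {it : Fin m → Item} {cover : Finset ℕ}

/-- On typical arrival orders, the algorithm selects all sufficiently dense items that arrive
outside the covered windows, neither too early nor too late. -/
theorem Typical.mem_select (R : Regime n ℓ m k Γ) (hT : Typical ℓ k Γ it cover x)
    (ha : 601 ≤ a₄) (hv : ∀ i, (it i).Valid) (hx : ∀ s, (x s).Valid)
    (hc : (cover.card : ℝ) ≤ Γ)
    (hW : ∀ s, window ℓ s ∉ cover → k + 1 < load it (x s) → k < ∑ i, topSize it (k + 1) (it i))
    {t : Fin n} (ht : window ℓ t ∉ cover) {K : ℝ} (hK : 0 ≤ K)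
    (hKt : K * ((t : ℝ) + 1) ≤ k * ((t : ℝ) + 1 - 609 * (Γ * ℓ)))
    (hlate : (t : ℝ) / n * k + (6 + a₄) * (Γ * (ℓ / n * k)) ≤ k)
    (hup : prefixSize ℓ it cover K x (t + 1) ≤
      prefixMean n ℓ it cover K (t + 1) + Γ * (ℓ / n * k))
    (hup' : prefixSize ℓ it cover (k + 1) x t ≤
      prefixMean n ℓ it cover (k + 1) t + Γ * (ℓ / n * k))
    (hload : load it (x t) ≤ K) (hval : 0 < (x t).value) :
    t ∈ (primalAlg a₄ S).select x := by
  have hk := R.k_ge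
  have hk1 : 0 ≤ k + 1 := by linarith
  have hu := R.unit_ge
  have hu' := R.unit_le
  have hΓℓ : 0 ≤ Γ * (ℓ : ℝ) := mul_nonneg (by linarith [R.Γ_ge]) (Nat.cast_nonneg _)
  have htent : ∀ s, window ℓ s ∉ cover → Tentative S x s → load it (x s) ≤ k + 1 :=
    fun s hs h => hT.load_le R hv hx hc (hW s hs) (S.optimal x s h.1) h.2
  have hfeas : ∃ X, LPFeasible ℓ k Γ x t X := by
    refine ⟨0, zero_lpFeasible R ?_⟩
    have h1 : 0 ≤ K * ((t : ℝ) + 1) := by positivity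
    have h2 : 0 ≤ (t : ℝ) + 1 - 609 * (Γ * ℓ) :=
      nonneg_of_mul_nonneg_right (h1.trans hKt) (by linarith)
    linarith
  have hsel : ∀ s ∈ primalSelect a₄ S x t, window ℓ s ∉ cover →
      (x s).size = topSize it (k + 1) (x s) := fun s hs hsc => by
    rw [topSize, if_pos (htent s hsc (tentative_of_mem_primalSelect hs))]
  have hacc : Accept a₄ S x (primalSelect a₄ S x t) t := by
    refine ⟨⟨hfeas, hT.pos_of_load_le R hv hx hc ht hK hKt hup hload hval
      (S.optimal x t hfeas)⟩, ?_, ?_⟩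
    · have hcov : ∑ s ∈ primalSelect a₄ S x t with window ℓ s ∈ cover, (x s).size ≤
          Γ * (a₄ * (ℓ / n) * k) := by
        have h1 : ∑ s ∈ primalSelect a₄ S x t with window ℓ s ∈ cover, (x s).size =
            ∑ j ∈ cover, ∑ s ∈ primalSelect a₄ S x t with window ℓ s = j, (x s).size := by
          rw [← sum_fiberwise_of_maps_to (t := cover) (g := fun s => window ℓ s)
            (fun s hs => (mem_filter.1 hs).2)]
          refine sum_congr rfl fun j hj => sum_congr ?_ fun _ _ => rfl
          ext s
          simp only [mem_filter]
          constructor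
          · rintro ⟨⟨h1, _⟩, h2⟩; exact ⟨h1, h2⟩
          · rintro ⟨h1, h2⟩; exact ⟨⟨h1, h2 ▸ hj⟩, h2⟩
        have ha0 : 0 ≤ a₄ * (ℓ / n) * k := by
          rw [mul_assoc]; exact mul_nonneg (by linarith) (by linarith)
        rw [h1]
        refine (sum_le_sum fun j _ => sum_window_primalSelect_le ha0 hx _ j).trans ?_
        rw [sum_const, nsmul_eq_mul]
        exact mul_le_mul_of_nonneg_right hc ha0
      have hfree : ∑ s ∈ primalSelect a₄ S x t with window ℓ s ∉ cover, (x s).size ≤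
          prefixSize ℓ it cover (k + 1) x t := by
        rw [prefixSize]
        refine (sum_le_sum fun s hs =>
          (hsel s (mem_filter.1 hs).1 (mem_filter.1 hs).2).le).trans ?_
        refine sum_le_sum_of_subset_of_nonneg (fun s hs => ?_) fun s _ _ => topSize_nonneg (hx s) _
        exact mem_filter.2 ⟨mem_univ _, (mem_filter.1 hs).2,
          lt_of_mem_primalSelect a₄ S x _ s (mem_filter.1 hs).1⟩
      have hsplit := sum_filter_add_sum_filter_not (primalSelect a₄ S x t)
        (fun s => window ℓ s ∈ cover) fun s => (x s).size
      have hmean := R.prefixMean_le hv cover hk1 (i := t) t.isLt.le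
      -- The units in `hlate`: a₄ for the covered windows, 2 for the excess of the mean, 1 for the
      -- deviation. As ΓL ≥ 1, the other 3 cover t/n + 2Γℓ/n ≤ 2, which comes from k + 1 in place of
      -- k, and the size 1 reserved for the new item.
      have h1 : (t : ℝ) / n ≤ 1 :=
        div_le_one_of_le₀ (by exact_mod_cast t.isLt.le) (Nat.cast_nonneg _)
      have h2 : Γ * ((ℓ : ℝ) / n) ≤ 1 / 2 := by rw [← mul_div_assoc]; exact R.burst_le
      have e1 : ((t : ℝ) / n + 2 * (Γ * (ℓ / n))) * (k + 1) =
        t / n * k + 2 * (Γ * (ℓ / n * k)) + t / n + 2 * (Γ * (ℓ / n)) := by ring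
      have e2 : Γ * (a₄ * (ℓ / n) * k) = a₄ * (Γ * ((ℓ : ℝ) / n * k)) := by ring
      linarith
    -- The outer constraint does not bind: 600L ≤ 601L - 1 ≤ a₄L - 1. This is where a₄ ≥ 601 is
    -- needed.
    · have h1 : ∑ s ∈ primalSelect a₄ S x t with window ℓ s = window ℓ t, (x s).size ≤
          ∑ q with window ℓ q = window ℓ t, topSize it (k + 1) (x q) := by
        refine (sum_le_sum fun s hs => (hsel s (mem_filter.1 hs).1 ?_).le).trans ?_
        · rw [(mem_filter.1 hs).2]; exact ht
        · exact sum_le_sum_of_subset_of_nonneg (filter_subset_filter _ (subset_univ _))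
            fun s _ _ => topSize_nonneg (hx s) _
      have h2 := hT.inner _ (window_mem_range t) ht
      have h3 : 601 * ((ℓ : ℝ) / n * k) ≤ a₄ * (ℓ / n * k) :=
        mul_le_mul_of_nonneg_right ha (by linarith)
      rw [mul_assoc a₄]
      linarith
  change t ∈ primalSelect a₄ S x n
  rw [mem_primalSelect_iff a₄ S x t n t.isLt, primalSelect, dif_pos t.isLt, if_pos hacc]
  exact mem_insert_self _ _

end Acceptance

/-! ### Arrival orders are typical with high probability -/

namespace Instance

variable {n ℓ : ℕ} {k Γ : ℝ} {Ω : Type} (B : Instance n ℓ Γ Ω)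

theorem mem_RO_of_window_notMem {t : Fin n} (ht : window ℓ t ∉ B.cover) : t ∈ B.RO := by
  by_contra h
  exact ht (B.covers t h)

theorem arrival_valid (I : {t // t ∈ B.RO} ≃ Fin B.RO.card) (ω : Ω) (t : Fin n) :
    (B.arrival I ω t).Valid := by
  unfold arrival
  split_ifs
  · exact B.item_valid _
  · exact B.adv_valid _ _ _

theorem sum_arrival (I : {t // t ∈ B.RO} ≃ Fin B.RO.card) (ω : Ω) (φ : Item → ℝ)
    {F : Finset (Fin n)} (hF : ∀ s ∈ F, s ∈ B.RO) :
    ∑ s ∈ F, φ (B.arrival I ω s) =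
      ∑ s ∈ F.subtype (· ∈ B.RO), φ (B.item (I s)) := by
  rw [← sum_subtype_of_mem _ hF]
  refine sum_congr rfl fun s _ => ?_
  rw [arrival, dif_pos s.2]

theorem card_subtype_RO {F : Finset (Fin n)} (hF : ∀ s ∈ F, s ∈ B.RO) :
    #(F.subtype (· ∈ B.RO)) = #F := by
  rw [card_subtype, filter_true_of_mem hF]

theorem abs_sum_arrival_swap_sub_le (I : {t // t ∈ B.RO} ≃ Fin B.RO.card) (ω : Ω) {φ : Item → ℝ}
    (h0 : ∀ y : Item, y.Valid → 0 ≤ φ y) (h1 : ∀ y : Item, y.Valid → φ y ≤ 1)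
    {F : Finset (Fin n)} (hF : ∀ s ∈ F, s ∈ B.RO) (a b : {t // t ∈ B.RO}) :
    |∑ s ∈ F, φ (B.arrival ((Equiv.swap a b).trans I) ω s) - ∑ s ∈ F, φ (B.arrival I ω s)|
      ≤ 1 := by
  rw [B.sum_arrival _ ω φ hF, B.sum_arrival _ ω φ hF]
  exact abs_sum_comp_swap_sub_le (h := fun s => φ (B.item (I s))) (fun s => h0 _ (B.item_valid _))
    (fun s => h1 _ (B.item_valid _)) _ a b

theorem expect_topSize_le {K : ℝ} (hK : 0 ≤ K) :
    𝔼 j, topSize B.item K (B.item j) ≤ K / B.RO.card := by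
  rw [Fintype.expect_eq_sum_div_card, Fintype.card_fin]
  exact div_le_div_of_nonneg_right (sum_topSize_le B.item_valid hK) (Nat.cast_nonneg _)

/-! ### Tail bounds and the union bound -/

section Tails

variable (R : Regime n ℓ B.RO.card k Γ)
include R

theorem prefixMean_le_size {K : ℝ} (hK : 0 ≤ K) (i : ℕ) :
    prefixMean n ℓ B.item B.cover K i ≤ K := by
  have h1 : #{s : Fin n | window ℓ s ∉ B.cover ∧ (s : ℕ) < i} ≤ B.RO.card :=
    card_le_card fun s hs => B.mem_RO_of_window_notMem (mem_filter.1 hs).2.1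
  rw [prefixMean]
  calc _ ≤ (B.RO.card : ℝ) * (K / B.RO.card) :=
        mul_le_mul (by exact_mod_cast h1) (B.expect_topSize_le hK)
          (expect_nonneg fun j _ => topSize_nonneg (B.item_valid j) K) (Nat.cast_nonneg _)
    _ = K := mul_div_cancel₀ _ R.m_pos.ne'

/-- With D = ΓL ≥ 2 and M ≤ 2k, the nearly optimal rate D/(8k) gives the exponent -D²/(32k), and Γ²
≥ k turns D²/k into at least L². The deviation is D - 1 to leave room for one exchange of samples.
-/
theorem tail_exponent_le {M : ℝ} (hM : M ≤ k + 1) :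
    (Γ * (ℓ / n * k) / (8 * k)) ^ 2 * M -
      Γ * (ℓ / n * k) / (8 * k) * (Γ * (ℓ / n * k) - 1) ≤ -((ℓ / n * k) ^ 2 / 32) := by
  have hk := R.k_ge
  have hu := R.unit_ge
  have hD : 2 ≤ Γ * ((ℓ : ℝ) / n * k) := by
    have : 2 ≤ Γ := by nlinarith [R.le_sq, R.Γ_ge]
    nlinarith
  set L : ℝ := (ℓ : ℝ) / n * k
  set D := Γ * L with hDdef
  have hkL : k * L ^ 2 ≤ D ^ 2 := by
    have e : D ^ 2 = Γ ^ 2 * L ^ 2 := by rw [hDdef, mul_pow]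
    rw [e]
    exact mul_le_mul_of_nonneg_right R.le_sq (sq_nonneg L)
  have h1 : (D / (8 * k)) ^ 2 * M ≤ (D / (8 * k)) ^ 2 * (2 * k) :=
    mul_le_mul_of_nonneg_left (by linarith) (sq_nonneg _)
  have h2 : D / (8 * k) * (D / 2) ≤ D / (8 * k) * (D - 1) :=
    mul_le_mul_of_nonneg_left (by linarith) (by positivity)
  have h3 : (D / (8 * k)) ^ 2 * (2 * k) - D / (8 * k) * (D / 2) = -(D ^ 2 / k / 32) := by
    field_simp; ring
  have h4 : L ^ 2 ≤ D ^ 2 / k := by rw [le_div_iff₀ (by linarith)]; linarith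
  linarith

theorem tail_rate_mem : 0 ≤ Γ * (ℓ / n * k) / (8 * k) ∧ Γ * (ℓ / n * k) / (8 * k) ≤ 1 := by
  have hk := R.k_ge
  have hu := R.unit_ge
  have h0 : 0 ≤ Γ * (ℓ / n * k) := mul_nonneg (by linarith [R.Γ_ge]) (by linarith)
  refine ⟨by positivity, ?_⟩
  rw [div_le_one (by linarith)]
  have e : Γ * (ℓ / n * k) = Γ * ℓ / n * k := by ring
  rw [e]
  nlinarith [R.burst_le]

theorem prob_prefixSize_ge_le (ω : Ω) {K : ℝ} (hK : 0 ≤ K) (hKk : K ≤ k + 1) (i : ℕ) :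
    prob (fun I => prefixMean n ℓ B.item B.cover K i + Γ * (ℓ / n * k) - 1 ≤
      prefixSize ℓ B.item B.cover K (B.arrival I ω) i) ≤ Real.exp (-((ℓ / n * k) ^ 2 / 32)) := by
  have hF : ∀ s ∈ univ.filter fun s : Fin n => window ℓ s ∉ B.cover ∧ (s : ℕ) < i, s ∈ B.RO :=
    fun s hs => B.mem_RO_of_window_notMem (mem_filter.1 hs).2.1
  have h := prob_upper_tail_le (g := fun j => topSize B.item K (B.item j))
    (fun j => topSize_nonneg (B.item_valid j) K) (fun j => topSize_le_one (B.item_valid j) K)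
    ((univ.filter fun s : Fin n => window ℓ s ∉ B.cover ∧ (s : ℕ) < i).subtype (· ∈ B.RO))
    (tail_rate_mem B R).1 (tail_rate_mem B R).2
    (prefixMean n ℓ B.item B.cover K i + Γ * (ℓ / n * k) - 1)
  rw [B.card_subtype_RO hF] at h
  simp only [prefixSize, B.sum_arrival _ ω _ hF]
  refine h.trans (Real.exp_le_exp.2 ?_)
  refine le_trans (le_of_eq ?_)
    (B.tail_exponent_le R ((B.prefixMean_le_size R hK i).trans hKk))
  rw [prefixMean]; ring

theorem prob_prefixSize_le_le (ω : Ω) {K : ℝ} (hK : 0 ≤ K) (hKk : K ≤ k + 1) (i : ℕ) :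
    prob (fun I => prefixSize ℓ B.item B.cover K (B.arrival I ω) i ≤
      prefixMean n ℓ B.item B.cover K i - Γ * (ℓ / n * k) + 1) ≤
      Real.exp (-((ℓ / n * k) ^ 2 / 32)) := by
  have hF : ∀ s ∈ univ.filter fun s : Fin n => window ℓ s ∉ B.cover ∧ (s : ℕ) < i, s ∈ B.RO :=
    fun s hs => B.mem_RO_of_window_notMem (mem_filter.1 hs).2.1
  have h := prob_lower_tail_le (g := fun j => topSize B.item K (B.item j))
    (fun j => topSize_nonneg (B.item_valid j) K) (fun j => topSize_le_one (B.item_valid j) K)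
    ((univ.filter fun s : Fin n => window ℓ s ∉ B.cover ∧ (s : ℕ) < i).subtype (· ∈ B.RO))
    (tail_rate_mem B R).1 (tail_rate_mem B R).2
    (prefixMean n ℓ B.item B.cover K i - Γ * (ℓ / n * k) + 1)
  rw [B.card_subtype_RO hF] at h
  simp only [prefixSize, B.sum_arrival _ ω _ hF]
  refine h.trans (Real.exp_le_exp.2 ?_)
  refine le_trans (le_of_eq ?_)
    (B.tail_exponent_le R ((B.prefixMean_le_size R hK i).trans hKk))
  rw [prefixMean]; ring

theorem prob_window_ge_le (ω : Ω) {j : ℕ} (hj : j ∉ B.cover) :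
    prob (fun I => 600 * (ℓ / n * k) - 1 ≤
      ∑ q with window ℓ q = j, topSize B.item (k + 1) (B.arrival I ω q)) ≤
      Real.exp (-(2 * (ℓ / n * k))) := by
  have hk := R.k_ge
  have hu := R.unit_ge
  have hF : ∀ s ∈ univ.filter fun s : Fin n => window ℓ s = j, s ∈ B.RO :=
    fun s hs => B.mem_RO_of_window_notMem (by rw [(mem_filter.1 hs).2]; exact hj)
  -- Rate 1 suffices: the mean is at most 4L, so the exponent is at most 8L - 600L + 1 ≤ -2L.
  have h := prob_upper_tail_le (g := fun j => topSize B.item (k + 1) (B.item j))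
    (fun j => topSize_nonneg (B.item_valid j) _) (fun j => topSize_le_one (B.item_valid j) _)
    ((univ.filter fun s : Fin n => window ℓ s = j).subtype (· ∈ B.RO))
    zero_le_one le_rfl (600 * (ℓ / n * k) - 1)
  rw [B.card_subtype_RO hF] at h
  simp only [B.sum_arrival _ ω _ hF]
  refine h.trans (Real.exp_le_exp.2 ?_)
  have h1 : (#{s : Fin n | window ℓ s = j} : ℝ) * (𝔼 j, topSize B.item (k + 1) (B.item j)) ≤
      ℓ * ((k + 1) / B.RO.card) :=
    mul_le_mul (by exact_mod_cast card_window_le R.ell_pos j)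
      (B.expect_topSize_le (by linarith))
      (expect_nonneg fun j _ => topSize_nonneg (B.item_valid j) _) (Nat.cast_nonneg _)
  have h2 : (k + 1) / B.RO.card ≤ 4 * k / n := by
    rw [div_le_div_iff₀ R.m_pos R.n_pos]
    nlinarith [R.n_le_two_mul, R.m_pos]
  have h3 : (ℓ : ℝ) * ((k + 1) / B.RO.card) ≤ ℓ * (4 * k / n) :=
    mul_le_mul_of_nonneg_left h2 (Nat.cast_nonneg _)
  have e : (ℓ : ℝ) * (4 * k / n) = 4 * (ℓ / n * k) := by ring
  linarith

theorem card_range_window_le : ((range (n / ℓ + 1)).card : ℝ) ≤ 2 * k := by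
  have hℓ : (0 : ℝ) < ℓ := by exact_mod_cast R.ell_pos
  have h1 : ((n / ℓ : ℕ) : ℝ) ≤ n / ℓ := Nat.cast_div_le
  have h2 : (n : ℝ) / ℓ ≤ k := by
    rw [div_le_iff₀ hℓ]
    have := R.unit_ge
    rw [div_mul_eq_mul_div, le_div_iff₀ R.n_pos] at this
    linarith
  rw [card_range]
  push_cast
  linarith [R.k_ge]

/-- From L²/32 ≥ 2L - 32 and L ≥ ln k - 1/2, both exponents are at most 33 - 2 ln k. The square in
k² leaves 1/k after the union over O(k) windows. -/
theorem exp_neg_unit_le : Real.exp (-(2 * (ℓ / n * k))) ≤ Real.exp 33 / k ^ 2 ∧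
    Real.exp (-((ℓ / n * k) ^ 2 / 32)) ≤ Real.exp 33 / k ^ 2 := by
  have hk : 0 < k := by linarith [R.k_ge]
  have h1 : Real.exp 33 / k ^ 2 = Real.exp (33 - 2 * Real.log k) := by
    rw [Real.exp_sub, two_mul, Real.exp_add, Real.exp_log hk, sq]
  have hl := R.log_le
  rw [h1]
  refine ⟨Real.exp_le_exp.2 (by linarith), Real.exp_le_exp.2 ?_⟩
  nlinarith [sq_nonneg ((ℓ : ℝ) / n * k - 32)]

/-- Conditioned on the time of arrival of one item, the order is typical with high probability. -/
theorem one_sub_le_card_mul_prob_typical (ω : Ω) {K : ℝ} (hK : 0 ≤ K) (hKk : K ≤ k)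
    (t : {t // t ∈ B.RO}) (i : Fin B.RO.card) :
    1 - 10 * Real.exp 33 / k ≤ B.RO.card * prob fun I => I t = i ∧
      (Typical ℓ k Γ B.item B.cover (B.arrival I ω) ∧
      prefixSize ℓ B.item B.cover K (B.arrival I ω) (t + 1) ≤
        prefixMean n ℓ B.item B.cover K (t + 1) + Γ * (ℓ / n * k) ∧
      prefixSize ℓ B.item B.cover (k + 1) (B.arrival I ω) t ≤
        prefixMean n ℓ B.item B.cover (k + 1) t + Γ * (ℓ / n * k)) := by
  classical
  have hk := R.k_ge
  have hk1 : 0 ≤ k + 1 := by linarith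
  obtain ⟨hp0, hp1⟩ := B.exp_neg_unit_le R
  set p := Real.exp 33 / k ^ 2 with hp
  have hp_nonneg : 0 ≤ p := by positivity
  -- The events `q1` to `q4` are the violations weakened by one unit: an exchange of two samples
  -- moves each sum by at most 1, so a violation for I implies one of them after any exchange with
  -- t.
  let q1 (I : {t // t ∈ B.RO} ≃ Fin B.RO.card) : Prop := ∃ j ∈ range (n / ℓ + 1),
    j ∉ B.cover ∧ 600 * (ℓ / n * k) - 1 ≤
      ∑ q with window ℓ q = j, topSize B.item (k + 1) (B.arrival I ω q)
  let q2 (I : {t // t ∈ B.RO} ≃ Fin B.RO.card) : Prop := ∃ j ∈ range (n / ℓ + 1),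
    prefixSize ℓ B.item B.cover (k + 1) (B.arrival I ω) (j * ℓ) ≤
      prefixMean n ℓ B.item B.cover (k + 1) (j * ℓ) - Γ * (ℓ / n * k) + 1
  let q3 (I : {t // t ∈ B.RO} ≃ Fin B.RO.card) : Prop :=
    prefixMean n ℓ B.item B.cover K (t + 1) + Γ * (ℓ / n * k) - 1 ≤
      prefixSize ℓ B.item B.cover K (B.arrival I ω) (t + 1)
  let q4 (I : {t // t ∈ B.RO} ≃ Fin B.RO.card) : Prop :=
    prefixMean n ℓ B.item B.cover (k + 1) t + Γ * (ℓ / n * k) - 1 ≤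
      prefixSize ℓ B.item B.cover (k + 1) (B.arrival I ω) t
  have hne : Nonempty ({t // t ∈ B.RO} ≃ Fin B.RO.card) := ⟨B.RO.equivFin⟩
  have hcard := B.card_range_window_le R
  have h1 : prob q1 ≤ 2 * k * p := by
    refine (prob_exists_le _ _ (c := p) fun j _ => ?_).trans
      (mul_le_mul_of_nonneg_right hcard hp_nonneg)
    by_cases hj : j ∈ B.cover
    · simpa [hj, prob] using hp_nonneg
    · simp only [hj, not_false_eq_true, true_and]
      exact (B.prob_window_ge_le R ω hj).trans hp0
  have h2 : prob q2 ≤ 2 * k * p :=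
    (prob_exists_le _ _ (c := p) fun j _ =>
      (B.prob_prefixSize_le_le R ω hk1 le_rfl _).trans hp1).trans
      (mul_le_mul_of_nonneg_right hcard hp_nonneg)
  have h3 : prob q3 ≤ p := (B.prob_prefixSize_ge_le R ω hK (by linarith) _).trans hp1
  have h4 : prob q4 ≤ p := (B.prob_prefixSize_ge_le R ω hk1 le_rfl _).trans hp1
  have hq : prob (fun I => (q1 I ∨ q2 I) ∨ (q3 I ∨ q4 I)) ≤ 10 * Real.exp 33 / k := by
    have e1 := prob_or_le (fun I => q1 I ∨ q2 I) (fun I => q3 I ∨ q4 I)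
    have e2 := prob_or_le q1 q2
    have e3 := prob_or_le q3 q4
    have e4 : k * p = Real.exp 33 / k := by rw [hp]; field_simp
    have e5 : p ≤ k * p := le_mul_of_one_le_left hp_nonneg (by linarith)
    have e6 : 10 * Real.exp 33 / k = 10 * (k * p) := by rw [e4]; ring
    linarith
  have hmain := le_card_mul_prob_cond t i (p := fun I =>
      ¬ (Typical ℓ k Γ B.item B.cover (B.arrival I ω) ∧
      prefixSize ℓ B.item B.cover K (B.arrival I ω) (t + 1) ≤
        prefixMean n ℓ B.item B.cover K (t + 1) + Γ * (ℓ / n * k) ∧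
      prefixSize ℓ B.item B.cover (k + 1) (B.arrival I ω) t ≤
        prefixMean n ℓ B.item B.cover (k + 1) t + Γ * (ℓ / n * k)))
    (q := fun I => (q1 I ∨ q2 I) ∨ (q3 I ∨ q4 I)) ?_
  · simp only [not_not, Fintype.card_coe] at hmain
    linarith
  · intro I b
    contrapose!
    rintro ⟨⟨n1, n2⟩, n3, n4⟩
    have hpre : ∀ K i, |prefixSize ℓ B.item B.cover K (B.arrival ((Equiv.swap t b).trans I) ω) i -
        prefixSize ℓ B.item B.cover K (B.arrival I ω) i| ≤ 1 := fun K i =>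
      B.abs_sum_arrival_swap_sub_le I ω (fun y hy => topSize_nonneg hy K)
        (fun y hy => topSize_le_one hy K)
        (fun s hs => B.mem_RO_of_window_notMem (mem_filter.1 hs).2.1) t b
    refine ⟨⟨fun j hj hjc => ?_, fun j hj => ?_⟩, ?_, ?_⟩
    · have := B.abs_sum_arrival_swap_sub_le I ω (fun y hy => topSize_nonneg (it := B.item) hy (k + 1))
        (fun y hy => topSize_le_one hy (k + 1)) (F := univ.filter fun q => window ℓ q = j)
        (fun s hs => B.mem_RO_of_window_notMem (by rw [(mem_filter.1 hs).2]; exact hjc)) t b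
      by_contra! hcon
      exact n1 ⟨j, hj, hjc, by linarith [(abs_le.1 this).1]⟩
    · by_contra! hcon
      exact n2 ⟨j, hj, by linarith [(abs_le.1 (hpre (k + 1) (j * ℓ))).2]⟩
    · by_contra! hcon
      exact n3 (by simp only [q3]; linarith [(abs_le.1 (hpre K (t + 1))).1])
    · by_contra! hcon
      exact n4 (by simp only [q4]; linarith [(abs_le.1 (hpre (k + 1) t)).1])

end Tails

end Instance

/-! ### The expected value of the primal algorithm -/

/-! ### Counting early and late times; a harmonic sum -/

section Sums

theorem card_filter_succ_lt_le (n : ℕ) {r : ℝ} (hr : 0 ≤ r) :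
    (#{t : Fin n | (t : ℝ) + 1 < r} : ℝ) ≤ r := by
  have h1 : #{t : Fin n | (t : ℝ) + 1 < r} ≤ #{t : Fin n | (t : ℕ) < ⌊r⌋₊} := by
    refine card_le_card fun t ht => ?_
    simp only [mem_filter, mem_univ, true_and] at ht ⊢
    exact Nat.le_floor (by push_cast; exact ht.le)
  rw [Fin.card_filter_val_lt] at h1
  have h2 : #{t : Fin n | (t : ℝ) + 1 < r} ≤ ⌊r⌋₊ := h1.trans (min_le_right _ _)
  exact (by exact_mod_cast h2 : (#{t : Fin n | (t : ℝ) + 1 < r} : ℝ) ≤ ⌊r⌋₊).trans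
    (Nat.floor_le hr)

theorem card_filter_lt_add_le (n : ℕ) {r : ℝ} (hr : 0 ≤ r) :
    (#{t : Fin n | (n : ℝ) < t + r} : ℝ) ≤ r := by
  refine le_trans ?_ (card_filter_succ_lt_le n hr)
  refine Nat.cast_le.2 (card_le_card_of_injOn Fin.rev (fun t ht => ?_) Fin.rev_injective.injOn)
  have ht' := (mem_filter.1 (mem_coe.1 ht)).2
  refine mem_coe.2 (mem_filter.2 ⟨mem_univ _, ?_⟩)
  have h : ((Fin.rev t : Fin n) : ℕ) + 1 + t = n := by
    rw [Fin.val_rev]; omega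
  have h' : ((Fin.rev t : Fin n) : ℝ) + 1 + t = n := by exact_mod_cast h
  linarith

/-- Induction with 1/(n + 1) ≤ ln((n + 1)/n); the first term present is at most 1. The case
distinction carries the induction through the values of n for which the sum is still empty. -/
theorem sum_range_inv_succ_le {r : ℝ} (hr : 1 ≤ r) (n : ℕ) :
    ∑ t ∈ (range n).filter (fun t : ℕ => r ≤ (t : ℝ) + 1), 1 / ((t : ℝ) + 1) ≤
      if r ≤ n then 1 + Real.log (n / r) else 0 := by
  induction n with
  | zero => rw [if_neg (by push_cast; linarith)]; simp
  | succ n ih =>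
    rw [range_add_one, filter_insert]
    push_cast
    have hn1 : (0 : ℝ) < (n : ℝ) + 1 := by positivity
    by_cases h1 : r ≤ (n : ℝ) + 1
    · rw [if_pos h1, if_pos h1, sum_insert (by simp)]
      by_cases h2 : r ≤ n
      · rw [if_pos h2] at ih
        have hn : (0 : ℝ) < n := by linarith
        have h3 := Real.one_sub_inv_le_log_of_pos (x := ((n : ℝ) + 1) / n) (by positivity)
        have h4 : Real.log (((n : ℝ) + 1) / r) = Real.log (((n : ℝ) + 1) / n) +
            Real.log (n / r) := by
          rw [← Real.log_mul (by positivity) (by positivity)]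
          congr 1; field_simp
        have h5 : 1 - (((n : ℝ) + 1) / n)⁻¹ = 1 / ((n : ℝ) + 1) := by field_simp; ring
        linarith
      · rw [if_neg h2] at ih
        have h3 : 0 ≤ Real.log (((n : ℝ) + 1) / r) :=
          Real.log_nonneg (by rwa [le_div_iff₀ (by linarith), one_mul])
        have h4 : 1 / ((n : ℝ) + 1) ≤ 1 := by
          rw [div_le_one hn1]; linarith [(Nat.cast_nonneg n : (0 : ℝ) ≤ n)]
        linarith
    · rw [if_neg h1, if_neg h1]
      rw [if_neg (by linarith)] at ih
      exact ih

theorem sum_inv_succ_le {n : ℕ} {r : ℝ} (hr : 1 ≤ r) (hrn : r ≤ n) :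
    ∑ t ∈ univ.filter (fun t : Fin n => r ≤ (t : ℝ) + 1), 1 / ((t : ℝ) + 1) ≤ 1 + Real.log (n / r) := by
  have h := sum_range_inv_succ_le hr n
  rw [if_pos hrn, sum_filter, ← Fin.sum_univ_eq_sum_range
    (fun t : ℕ => if r ≤ (t : ℝ) + 1 then 1 / ((t : ℝ) + 1) else 0) n] at h
  rwa [sum_filter]

end Sums

namespace Instance

variable {n ℓ : ℕ} {k Γ : ℝ}

/-! ### The offline optimum and linearity of expectation -/

section Opt

variable {Ω : Type} (B : Instance n ℓ Γ Ω)

theorem optRO_nonneg (k : ℝ) : 0 ≤ B.optRO k := by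
  refine Real.sSup_nonneg ?_
  rintro r ⟨X, hX, _, rfl⟩
  exact sum_nonneg fun i _ => mul_nonneg (B.item_valid i).1 (hX i).1

theorem optRO_le {k : ℝ} (hk : 0 ≤ k) {c : ℝ}
    (h : ∀ X : Fin B.RO.card → ℝ, (∀ i, 0 ≤ X i ∧ X i ≤ 1) →
      ∑ i, (B.item i).size * X i ≤ k → ∑ i, (B.item i).value * X i ≤ c) : B.optRO k ≤ c := by
  refine csSup_le ⟨0, 0, fun i => ⟨le_rfl, zero_le_one⟩, by simpa using hk, by simp⟩ ?_
  rintro r ⟨X, hX, hXk, rfl⟩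
  exact h X hX hXk

theorem le_optRO {k : ℝ} {X : Fin B.RO.card → ℝ} (hX : ∀ i, 0 ≤ X i ∧ X i ≤ 1)
    (hXk : ∑ i, (B.item i).size * X i ≤ k) : ∑ i, (B.item i).value * X i ≤ B.optRO k := by
  refine le_csSup ⟨∑ i, (B.item i).value, ?_⟩ ⟨X, hX, hXk, rfl⟩
  rintro r ⟨Y, hY, _, rfl⟩
  exact sum_le_sum fun i _ => mul_le_of_le_one_right (B.item_valid i).1 (hY i).2

theorem mul_optRO_le (hd : B.DistinctDensities) {K : ℝ} (hK : 0 ≤ K) (hKk : K ≤ k) :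
    (K - 1) * B.optRO k ≤ k * ∑ i ∈ top B.item K, (B.item i).value := by
  have hV : 0 ≤ ∑ i ∈ top B.item K, (B.item i).value := sum_nonneg fun i _ => (B.item_valid i).1
  rcases le_or_gt K 1 with hK1 | hK1
  · exact (mul_nonpos_of_nonpos_of_nonneg (by linarith) (B.optRO_nonneg k)).trans
      (mul_nonneg (hK.trans hKk) hV)
  · rw [mul_comm, ← le_div_iff₀ (by linarith)]
    refine B.optRO_le (hK.trans hKk) fun X hX hXk => ?_
    rw [le_div_iff₀ (by linarith), mul_comm]
    exact mul_sum_value_le B.item_valid hd hK hKk hX hXk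

theorem expectedValue_nonneg [Fintype Ω] (A : Ω → OnlineAlg n) : 0 ≤ B.expectedValue A :=
  expect_nonneg fun ω _ => expect_nonneg fun I _ => sum_nonneg fun t _ =>
    (B.arrival_valid I ω t).1

theorem expectedValue_unit (B : Instance n ℓ Γ Unit) (A : Unit → OnlineAlg n) :
    B.expectedValue A = 𝔼 I : {t // t ∈ B.RO} ≃ Fin B.RO.card,
      ∑ t ∈ B.RO with t ∈ (A ()).select (B.arrival I ()), (B.arrival I () t).value :=
  expect_singleton _ _

theorem sum_le_expectedValue (B : Instance n ℓ Γ Unit) (A : OnlineAlg n) (F : Finset (Fin n)) (hF : ∀ t ∈ F, window ℓ t ∉ B.cover) :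
    ∑ t ∈ F, (𝔼 I : {t // t ∈ B.RO} ≃ Fin B.RO.card,
        if t ∈ A.select (B.arrival I ()) then (B.arrival I () t).value else 0) ≤
      B.expectedValue fun _ => A := by
  rw [expectedValue_unit, ← expect_sum_comm]
  refine expect_le_expect fun I _ => ?_
  rw [sum_filter]
  refine sum_le_sum_of_subset_of_nonneg
    (fun t ht => B.mem_RO_of_window_notMem (hF t ht)) fun t _ _ => ?_
  split_ifs
  · exact (B.arrival_valid I () t).1
  · exact le_rfl

end Opt

/-! ### Summing the value over the good times -/

section PrimalValue

variable (B : Instance n ℓ Γ Unit) (R : Regime n ℓ B.RO.card k Γ) (hd : B.DistinctDensities)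
  {a₄ : ℝ} (ha : 601 ≤ a₄) (S : LPSolver n ℓ k Γ)
include R hd ha

/-- The expected value that is collected at one time. -/
theorem le_expect_value_at {t : Fin n} (ht : window ℓ t ∉ B.cover) {K : ℝ} (hK : 0 ≤ K)
    (hKk : K ≤ k) (hKt : K * ((t : ℝ) + 1) ≤ k * ((t : ℝ) + 1 - 609 * (Γ * ℓ)))
    (hlate : (t : ℝ) / n * k + (6 + a₄) * (Γ * (ℓ / n * k)) ≤ k) :
    (1 - 10 * Real.exp 33 / k) / B.RO.card * ∑ i ∈ top B.item K, (B.item i).value ≤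
      𝔼 I : {t // t ∈ B.RO} ≃ Fin B.RO.card,
        if t ∈ (primalAlg a₄ S).select (B.arrival I ()) then (B.arrival I () t).value else 0 := by
  classical
  have hk := R.k_ge
  have htRO := B.mem_RO_of_window_notMem ht
  let good (I : {t // t ∈ B.RO} ≃ Fin B.RO.card) : Prop :=
    Typical ℓ k Γ B.item B.cover (B.arrival I ()) ∧
      prefixSize ℓ B.item B.cover K (B.arrival I ()) (t + 1) ≤
        prefixMean n ℓ B.item B.cover K (t + 1) + Γ * (ℓ / n * k) ∧
      prefixSize ℓ B.item B.cover (k + 1) (B.arrival I ()) t ≤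
        prefixMean n ℓ B.item B.cover (k + 1) t + Γ * (ℓ / n * k)
  have h1 : ∀ i, (1 - 10 * Real.exp 33 / k) / B.RO.card ≤
      prob fun I : {t // t ∈ B.RO} ≃ Fin B.RO.card => I ⟨t, htRO⟩ = i ∧ good I := fun i => by
    refine (div_le_iff₀' R.m_pos).2 ?_
    exact B.one_sub_le_card_mul_prob_typical R () hK hKk ⟨t, htRO⟩ i
  have h2 : ∑ i ∈ top B.item K, (B.item i).value * (prob fun I => I ⟨t, htRO⟩ = i ∧ good I) =
      𝔼 I : {t // t ∈ B.RO} ≃ Fin B.RO.card, ∑ i ∈ top B.item K,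
        (B.item i).value * (if I ⟨t, htRO⟩ = i ∧ good I then 1 else 0) := by
    rw [expect_sum_comm]
    refine sum_congr rfl fun i _ => ?_
    rw [prob, mul_expect]
    refine expect_congr rfl fun I _ => ?_
    congr
  calc _ ≤ ∑ i ∈ top B.item K, (B.item i).value * (prob fun I => I ⟨t, htRO⟩ = i ∧ good I) := by
        rw [mul_sum]
        refine sum_le_sum fun i _ => ?_
        rw [mul_comm]
        exact mul_le_mul_of_nonneg_left (h1 i) (B.item_valid i).1
    _ ≤ _ := by
        rw [h2]
        refine expect_le_expect fun I _ => ?_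
        have hval : 0 ≤ (B.arrival I () t).value := (B.arrival_valid I () t).1
        have hRHS : 0 ≤ if t ∈ (primalAlg a₄ S).select (B.arrival I ()) then
            (B.arrival I () t).value else 0 := by split_ifs <;> simp [hval]
        have harr : B.arrival I () t = B.item (I ⟨t, htRO⟩) := by rw [arrival, dif_pos htRO]
        by_cases hg : good I ∧ I ⟨t, htRO⟩ ∈ top B.item K
        · obtain ⟨⟨hT, hup, hup'⟩, htop⟩ := hg
          rw [sum_eq_single (I ⟨t, htRO⟩)]
          · rw [if_pos ⟨rfl, hT, hup, hup'⟩, mul_one, ← harr]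
            -- A worthless item may be skipped by the linear program, but then nothing is lost.
            rcases hval.eq_or_lt with h0 | h0
            · rwa [← h0] at hRHS ⊢
            · rw [if_pos]
              refine hT.mem_select R ha B.item_valid (B.arrival_valid I ()) B.card_cover ?_ ht hK
                hKt hlate hup hup' ?_ h0
              -- An uncovered arrival of load above k + 1 is a random-order item outside the top, so
              -- the top of size k + 1 is not the whole list and has size above k.
              · intro s hs hload
                rw [arrival, dif_pos (B.mem_RO_of_window_notMem hs)] at hload
                obtain ⟨_, _, _, _, hsep⟩ := exists_separating B.item_valid hd
                  (by linarith : 0 ≤ k + 1) ⟨_, hload⟩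
                rw [sum_topSize]
                linarith
              · rw [harr]; exact mem_top.1 htop
          · intro i _ hi
            rw [if_neg fun h => hi h.1.symm, mul_zero]
          · exact fun h => absurd htop h
        · refine le_trans (le_of_eq (sum_eq_zero fun i hi => ?_)) hRHS
          rw [if_neg, mul_zero]
          rintro ⟨rfl, h⟩
          exact hg ⟨h, hi⟩

/-- With b = Γℓ, the largest size admitted by `Typical.pos_of_load_le` at the t-th step is K = k(1 -
609b/t). Each item of the top of size K arrives then and is selected with probability at least (1 -
δ)/m. The losses 609b/t add up to at most 609b(1 + ln(n/b)). -/
theorem le_expectedValue_primalAlg :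
    (1 - (2 * (1226 + a₄ + 10 * Real.exp 33) + 609) *
      ((Γ * ℓ / n) * Real.log (n / (Γ * ℓ)))) * B.optRO k ≤
      B.expectedValue fun _ => primalAlg a₄ S := by
  classical
  have hk := R.k_ge
  have hn := R.n_pos
  have hm := R.m_pos
  have hΓℓ : 1 ≤ Γ * (ℓ : ℝ) := by
    have : (1 : ℝ) ≤ ℓ := by exact_mod_cast R.ell_pos
    nlinarith [R.Γ_ge]
  have hburst := R.burst_le
  set b := Γ * (ℓ : ℝ) with hb
  have hbn : b ≤ n := by rw [div_le_iff₀ hn] at hburst; linarith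
  set δ := 10 * Real.exp 33 / k with hδ
  have hδ0 : 0 ≤ δ := by positivity
  have hOPT := B.optRO_nonneg k
  have hE := B.expectedValue_nonneg fun _ => primalAlg a₄ S
  have hlog : 1 / 2 ≤ Real.log (n / b) := R.log_ge
  have hε : 1 / k ≤ b / n := R.inv_le
  -- 1225 = 616 + 609: the discarded times number at most (616 + a₄)b (b covered, 609b early, (6 +
  -- a₄)b late), and the 1 in the harmonic bound costs 609b. The 1/k comes from the K - 1 in
  -- `mul_optRO_le`.
  set y := (1225 + a₄) * (b / n) + 1 / k + 609 * (b / n * Real.log (n / b)) with hy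
  have hbn0 : 0 ≤ b / n := by positivity
  have hy0 : 0 ≤ y := by
    have h2 : 0 ≤ 1 / k := by positivity
    have h3 : 0 ≤ b / n * Real.log (n / b) := mul_nonneg hbn0 (by linarith)
    have h4 : 0 ≤ (1225 + a₄) * (b / n) := mul_nonneg (by linarith) hbn0
    linarith
  have hyC : y + δ ≤ (2 * (1226 + a₄ + 10 * Real.exp 33) + 609) *
      (b / n * Real.log (n / b)) := by
    have h1 : δ ≤ 10 * Real.exp 33 * (b / n) := by
      have e : δ = 10 * Real.exp 33 * (1 / k) := by rw [hδ]; ring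
      rw [e]
      exact mul_le_mul_of_nonneg_left hε (by positivity)
    have h2 : b / n ≤ 2 * (b / n * Real.log (n / b)) := by nlinarith
    have h3 : 0 ≤ 1226 + a₄ + 10 * Real.exp 33 := by
      have := Real.exp_pos 33
      linarith
    have h4 := mul_le_mul_of_nonneg_left h2 h3
    linarith
  suffices (1 - (y + δ)) * B.optRO k ≤ B.expectedValue fun _ => primalAlg a₄ S from
    (mul_le_mul_of_nonneg_right (by linarith) hOPT).trans this
  -- If δ ≥ 1 the claimed lower bound is nonpositive; this settles small k, where e³³ is too large.
  rcases le_or_gt (1 - δ) 0 with hδ1 | hδ1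
  · exact (mul_nonpos_of_nonpos_of_nonneg (by linarith) hOPT).trans hE
  let G : Finset (Fin n) := {t | window ℓ t ∉ B.cover ∧ 609 * b ≤ (t : ℝ) + 1 ∧
    (t : ℝ) + (6 + a₄) * b ≤ n}
  have hG : ∀ t ∈ G, window ℓ t ∉ B.cover ∧ 609 * b ≤ (t : ℝ) + 1 ∧
    (t : ℝ) + (6 + a₄) * b ≤ n := fun t ht => (mem_filter.1 ht).2
  have hcard : (n : ℝ) - (616 + a₄) * b ≤ #G := by
    have h1 : #(univ : Finset (Fin n)) ≤ (#{t : Fin n | window ℓ t ∈ B.cover} +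
        #{t : Fin n | (t : ℝ) + 1 < 609 * b} + #{t : Fin n | (n : ℝ) < t + (6 + a₄) * b}) + #G := by
      refine (card_le_card fun t _ => ?_).trans ((card_union_le _ _).trans
        (Nat.add_le_add_right ((card_union_le _ _).trans
          (Nat.add_le_add_right (card_union_le _ _) _)) _))
      simp only [G, mem_union, mem_filter, mem_univ, true_and, ← not_le]
      tauto
    have h2 : (n : ℝ) ≤ (#{t : Fin n | window ℓ t ∈ B.cover} : ℝ) +
        #{t : Fin n | (t : ℝ) + 1 < 609 * b} + #{t : Fin n | (n : ℝ) < t + (6 + a₄) * b} +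
        #G := by
      rw [card_univ, Fintype.card_fin] at h1
      exact_mod_cast h1
    have h3 : (#{t : Fin n | window ℓ t ∈ B.cover} : ℝ) ≤ b := by
      refine le_trans (b := (B.cover.card * ℓ : ℝ)) ?_
        (mul_le_mul_of_nonneg_right B.card_cover (Nat.cast_nonneg _))
      exact_mod_cast card_covered_le R.ell_pos B.cover
    have h4 := card_filter_succ_lt_le n (r := 609 * b) (by linarith)
    have h5 := card_filter_lt_add_le n (r := (6 + a₄) * b) (mul_nonneg (by linarith) (by linarith))
    linarith
  have hcard' : (#G : ℝ) ≤ n := by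
    have := card_le_univ G
    rw [Fintype.card_fin] at this
    exact_mod_cast this
  have hharm : ∑ t ∈ G, 1 / ((t : ℝ) + 1) ≤ 1 + Real.log (n / b) := by
    refine le_trans ?_ (sum_inv_succ_le hΓℓ hbn)
    refine sum_le_sum_of_subset_of_nonneg (fun t ht => ?_) fun t _ _ => by positivity
    refine mem_filter.2 ⟨mem_univ _, ?_⟩
    linarith [(hG t ht).2.1]
  have hsum : (n : ℝ) * (1 - y) ≤ ∑ t ∈ G, (1 - 609 * b * (1 / ((t : ℝ) + 1)) - 1 / k) := by
    rw [sum_sub_distrib, sum_sub_distrib, ← mul_sum, sum_const, sum_const, nsmul_eq_mul,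
      nsmul_eq_mul, mul_one]
    have h1 : 609 * b * ∑ t ∈ G, 1 / ((t : ℝ) + 1) ≤ 609 * b * (1 + Real.log (n / b)) :=
      mul_le_mul_of_nonneg_left hharm (by linarith)
    have h2 : (#G : ℝ) * (1 / k) ≤ n * (1 / k) :=
      mul_le_mul_of_nonneg_right hcard' (by positivity)
    have h3 : (n : ℝ) * (1 - y) = n - (1225 + a₄) * b - n * (1 / k) -
        609 * b * Real.log (n / b) := by
      rw [hy]; field_simp; ring
    linarith
  have hpoint : ∀ t ∈ G, (1 - δ) / n * ((1 - 609 * b * (1 / ((t : ℝ) + 1)) - 1 / k) * B.optRO k) ≤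
      𝔼 I : {t // t ∈ B.RO} ≃ Fin B.RO.card,
        if t ∈ (primalAlg a₄ S).select (B.arrival I ()) then (B.arrival I () t).value else 0 := by
    intro t ht
    obtain ⟨h1, h2, h3⟩ := hG t ht
    have ht0 : (0 : ℝ) < (t : ℝ) + 1 := by positivity
    have hK0 : 0 ≤ k * (1 - 609 * b * (1 / ((t : ℝ) + 1))) := by
      refine mul_nonneg (by linarith) (sub_nonneg.2 ?_)
      rw [mul_one_div, div_le_one ht0]
      exact h2
    have hKk : k * (1 - 609 * b * (1 / ((t : ℝ) + 1))) ≤ k := by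
      refine mul_le_of_le_one_right (by linarith) (sub_le_self _ ?_)
      positivity
    refine le_trans ?_ (B.le_expect_value_at R hd ha S h1 hK0 hKk (le_of_eq ?_) ?_)
    · have hopt := B.mul_optRO_le hd hK0 hKk
      set V := ∑ i ∈ top B.item (k * (1 - 609 * b * (1 / ((t : ℝ) + 1)))), (B.item i).value
      have hV : 0 ≤ V := sum_nonneg fun i _ => (B.item_valid i).1
      have h4 : (1 - 609 * b * (1 / ((t : ℝ) + 1)) - 1 / k) * B.optRO k ≤ V := by
        have e : (1 - 609 * b * (1 / ((t : ℝ) + 1)) - 1 / k) * B.optRO k =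
          (k * (1 - 609 * b * (1 / ((t : ℝ) + 1))) - 1) * B.optRO k / k := by field_simp
        rw [e, div_le_iff₀ (by linarith)]
        linarith
      have hmn : (B.RO.card : ℝ) ≤ n := by exact_mod_cast R.m_le
      exact (mul_le_mul_of_nonneg_left h4 (div_nonneg hδ1.le hn.le)).trans
        (mul_le_mul_of_nonneg_right (div_le_div_of_nonneg_left hδ1.le hm hmn) hV)
    · field_simp
      rw [hb, ← mul_assoc]
    · have e : (t : ℝ) / n * k + (6 + a₄) * (Γ * (ℓ / n * k)) =
        ((t : ℝ) + (6 + a₄) * b) / n * k := by rw [hb]; ring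
      rw [e]
      exact mul_le_of_le_one_left (by linarith) ((div_le_one hn).2 h3)
  refine le_trans ?_ (B.sum_le_expectedValue (primalAlg a₄ S) G fun t ht => (hG t ht).1)
  refine le_trans ?_ (sum_le_sum hpoint)
  rw [← mul_sum, ← sum_mul]
  have h1 : (1 - δ) / n * (n * (1 - y) * B.optRO k) ≤ (1 - δ) / n *
      ((∑ t ∈ G, (1 - 609 * b * (1 / ((t : ℝ) + 1)) - 1 / k)) * B.optRO k) :=
    mul_le_mul_of_nonneg_left (mul_le_mul_of_nonneg_right hsum hOPT)
      (div_nonneg hδ1.le hn.le)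
  refine le_trans ?_ h1
  have e : (1 - δ) / n * (n * (1 - y) * B.optRO k) = (1 - δ) * (1 - y) * B.optRO k := by
    field_simp
  rw [e]
  exact mul_le_mul_of_nonneg_right (by nlinarith [mul_nonneg hδ0 hy0]) hOPT

end PrimalValue

end Instance

/-! ### From the stated parameter range to `Regime`; comparing the two error terms -/

section Parameters

variable {n ℓ : ℕ} {k Γ : ℝ}

theorem three_le_log (hk : 80 ≤ k) : 3 ≤ Real.log k := by
  rw [Real.le_log_iff_exp_le (by linarith)]
  have h1 : Real.exp 3 = Real.exp 1 ^ 3 := by rw [← Real.exp_nat_mul]; norm_num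
  have h2 : Real.exp 1 ^ 3 ≤ 2.72 ^ 3 :=
    pow_le_pow_left₀ (Real.exp_pos 1).le (by linarith [Real.exp_one_lt_d9]) 3
  rw [h1]
  norm_num at h2 ⊢
  linarith

/-- Rounding moves ℓ by less than 1, hence L by less than k/n ≤ 1/2. -/
theorem abs_unit_sub_log_le (hk : 80 ≤ k) (hkn : k ≤ (n : ℝ) / 2)
    (hℓ : |(ℓ : ℝ) - n * Real.log k / k| < 1) : |(ℓ : ℝ) / n * k - Real.log k| ≤ 1 / 2 := by
  have hn : (0 : ℝ) < n := by linarith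
  have e : (ℓ : ℝ) / n * k - Real.log k = (ℓ - n * Real.log k / k) * (k / n) := by
    field_simp
  rw [e, abs_mul, abs_of_nonneg (by positivity : 0 ≤ k / n)]
  have h1 : k / n ≤ 1 / 2 := by rw [div_le_iff₀ hn]; linarith
  calc _ ≤ 1 * (k / n) := mul_le_mul_of_nonneg_right hℓ.le (by positivity)
    _ ≤ _ := by linarith

theorem Regime.of_params (hk : 80 ≤ k) (hkn : k ≤ (n : ℝ) / 2)
    (hℓ : |(ℓ : ℝ) - n * Real.log k / k| < 1) (hΓ : Real.sqrt k ≤ Γ) (hb : Γ * ℓ / n ≤ 1 / 2)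
    {m : ℕ} (hm : m ≤ n) (hnm : 0 < ℓ → (n : ℝ) ≤ m + Γ * ℓ) : Regime n ℓ m k Γ := by
  have hlog := three_le_log hk
  have hu := abs_le.1 (abs_unit_sub_log_le hk hkn hℓ)
  have hℓ0 : 0 < ℓ := by
    by_contra h
    have h0 : ℓ = 0 := by omega
    subst h0
    have := hu.1
    norm_num at this
    linarith
  have h1 : 1 ≤ Real.sqrt k := Real.one_le_sqrt.2 (by linarith)
  refine ⟨hk, hkn, hℓ0, by linarith, h1.trans hΓ, hb, hm, hnm hℓ0, ?_, by linarith⟩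
  rw [← Real.sqrt_le_left (by linarith)]
  exact hΓ

theorem Instance.regime {Ω : Type} (B : Instance n ℓ Γ Ω) (hk : 80 ≤ k) (hkn : k ≤ (n : ℝ) / 2)
    (hℓ : |(ℓ : ℝ) - n * Real.log k / k| < 1) (hΓ : Real.sqrt k ≤ Γ)
    (hb : Γ * ℓ / n ≤ 1 / 2) : Regime n ℓ B.RO.card k Γ := by
  classical
  refine Regime.of_params hk hkn hℓ hΓ hb ((card_le_univ _).trans_eq (Fintype.card_fin n))
    fun hℓ0 => ?_
  have h1 : #(univ : Finset (Fin n)) ≤ B.RO.card + #{t : Fin n | window ℓ t ∈ B.cover} := by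
    refine (card_le_card fun t _ => ?_).trans (card_union_le _ _)
    by_cases ht : t ∈ B.RO
    · exact mem_union_left _ ht
    · exact mem_union_right _ (mem_filter.2 ⟨mem_univ _, B.covers t ht⟩)
  rw [card_univ, Fintype.card_fin] at h1
  have h2 := card_covered_le (n := n) hℓ0 B.cover
  have h3 : (n : ℝ) ≤ B.RO.card + B.cover.card * ℓ := by exact_mod_cast h1.trans (by omega)
  have h4 := mul_le_mul_of_nonneg_right B.card_cover (Nat.cast_nonneg (α := ℝ) ℓ)
  linarith

/-- The two error terms are equivalent. -/
theorem error_le {m : ℕ} (R : Regime n ℓ m k Γ) (hℓ : |(ℓ : ℝ) - n * Real.log k / k| < 1) :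
    Γ * ℓ / n * Real.log (n / (Γ * ℓ)) ≤
      4 * (Γ * Real.log k / k * Real.log (k / (Γ * Real.log k))) := by
  have hk := R.k_ge
  have hn := R.n_pos
  have hlog := three_le_log hk
  have hu := abs_le.1 (abs_unit_sub_log_le hk R.k_le hℓ)
  have hΓ : 0 < Γ := by linarith [R.Γ_ge]
  have hℓ0 : (0 : ℝ) < ℓ := by exact_mod_cast R.ell_pos
  have h1 : Γ * ℓ / n ≤ 2 * (Γ * Real.log k / k) := by
    have e : Γ * ℓ / n = Γ * (ℓ / n * k) / k := by field_simp
    rw [e, ← mul_div_assoc]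
    refine div_le_div_of_nonneg_right ?_ (by linarith)
    nlinarith
  have h2 : 5 / 6 * ((n : ℝ) / (Γ * ℓ)) ≤ k / (Γ * Real.log k) := by
    have e : 5 / 6 * ((n : ℝ) / (Γ * ℓ)) = k / (Γ * (6 / 5 * (ℓ / n * k))) := by
      field_simp
    rw [e]
    refine div_le_div_of_nonneg_left (by linarith) (by positivity) ?_
    exact mul_le_mul_of_nonneg_left (by linarith) hΓ.le
  have h3 := R.log_ge
  have h3' : Real.log 2 ≤ Real.log (n / (Γ * ℓ)) := by
    have hburst := R.burst_le
    rw [div_le_iff₀ hn] at hburst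
    exact Real.log_le_log (by norm_num) (by rw [le_div_iff₀ (by positivity)]; linarith)
  -- Replacing ln k by 6L/5 costs at most 1/5 in the logarithm, less than half of ln 2.
  have h4 : 1 / 2 * Real.log (n / (Γ * ℓ)) ≤ Real.log (k / (Γ * Real.log k)) := by
    have h5 := Real.log_le_log (by positivity) h2
    rw [Real.log_mul (by norm_num) (by positivity)] at h5
    have h6 := Real.one_sub_inv_le_log_of_pos (x := 5 / 6) (by norm_num)
    norm_num at h6
    linarith [Real.log_two_gt_d9]
  calc Γ * ℓ / n * Real.log (n / (Γ * ℓ)) ≤ 2 * (Γ * Real.log k / k) * Real.log (n / (Γ * ℓ)) :=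
        mul_le_mul_of_nonneg_right h1 (by linarith)
    _ ≤ 2 * (Γ * Real.log k / k) * (2 * Real.log (k / (Γ * Real.log k))) :=
        mul_le_mul_of_nonneg_left (by linarith) (by positivity)
    _ = _ := by ring

theorem Instance.attains_of_le {Ω : Type} [Fintype Ω] {B : Instance n ℓ Γ Ω}
    {A : Ω → OnlineAlg n} (R : Regime n ℓ B.RO.card k Γ)
    (hℓ : |(ℓ : ℝ) - n * Real.log k / k| < 1) {C : ℝ} (hC : 0 ≤ C)
    (h : (1 - C * ((Γ * ℓ / n) * Real.log (n / (Γ * ℓ)))) * B.optRO k ≤ B.expectedValue A) :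
    B.Attains A k (4 * C) := by
  have h0 := B.optRO_nonneg k
  have h1 := mul_le_mul_of_nonneg_left (error_le R hℓ) hC
  have h2 : 0 ≤ Γ * ℓ / n * Real.log (n / (Γ * ℓ)) := by
    refine mul_nonneg ?_ (by linarith [R.log_ge])
    exact (by have := R.k_ge; positivity : 0 ≤ 1 / k).trans R.inv_le
  have h3 := mul_nonneg hC h2
  exact ⟨(mul_le_mul_of_nonneg_right (by linarith) h0).trans h,
    (mul_le_mul_of_nonneg_right (by linarith) h0).trans h⟩

end Parameters

/-! ### Existence of an online rule for the linear programs -/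

section Solver

variable {n ℓ : ℕ} {k Γ : ℝ} {x y : Fin n → Item} {t : Fin n}

theorem exists_lpOptimal (h : ∃ X, LPFeasible ℓ k Γ x t X) : ∃ X, LPOptimal ℓ k Γ x t X := by
  have hcont : ∀ (F : Finset (Fin n)) (u : Fin n → ℝ),
      Continuous fun X : Fin n → ℝ => ∑ s ∈ F, u s * X s := fun F u => by fun_prop
  have hset : {X | LPFeasible ℓ k Γ x t X} = Set.Icc 0 1 ∩ ({X | ∀ s, t < s → X s = 0} ∩
      ({X | ∑ s ∈ Iic t, (x s).size * X s ≤
        (1 - 4 * Γ * ℓ / ((t : ℝ) + 1)) * (((t : ℝ) + 1) / n) * k} ∩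
      {X | ∀ j : ℕ, ∑ s ∈ Iic t with window ℓ s = j, (x s).size * X s ≤
        601 * (ℓ / n) * k})) := by
    ext X
    constructor
    · rintro ⟨h1, h2, h3, h4, h5⟩
      exact ⟨⟨h1, h2⟩, h3, h4, h5⟩
    · rintro ⟨⟨h1, h2⟩, h3, h4, h5⟩
      exact ⟨h1, h2, h3, h4, h5⟩
  have hcomp : IsCompact {X | LPFeasible ℓ k Γ x t X} := by
    rw [hset]
    refine isCompact_Icc.inter_right (IsClosed.inter ?_ (IsClosed.inter ?_ ?_))
    · simp only [Set.ofPred_forall]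
      exact isClosed_iInter fun s => isClosed_iInter fun _ =>
        isClosed_eq (continuous_apply s) continuous_const
    · exact isClosed_le (hcont _ fun s => (x s).size) continuous_const
    · simp only [Set.ofPred_forall]
      exact isClosed_iInter fun j => isClosed_le (hcont _ fun s => (x s).size) continuous_const
  obtain ⟨X, hX, hmax⟩ := hcomp.exists_isMaxOn h (hcont (Iic t) fun s => (x s).value).continuousOn
  exact ⟨X, hX, fun Y hY => hmax hY⟩

theorem LPOptimal.congr (h : ∀ s ≤ t, x s = y s) {X : Fin n → ℝ} (hX : LPOptimal ℓ k Γ x t X) :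
    LPOptimal ℓ k Γ y t X := by
  refine ⟨hX.1.congr h, fun Y hY => ?_⟩
  have hval : ∀ Z : Fin n → ℝ, ∑ s ∈ Iic t, (y s).value * Z s = ∑ s ∈ Iic t, (x s).value * Z s :=
    fun Z => sum_congr rfl fun s hs => by rw [h s (mem_Iic.1 hs)]
  rw [hval, hval]
  exact hX.2 Y (hY.congr fun s hs => (h s hs).symm)

/-- Optimal solutions exist by compactness. They are chosen for the sequence with its future blanked
out, so that the choice depends on the past only. -/
theorem nonempty_lpSolver (n ℓ : ℕ) (k Γ : ℝ) : Nonempty (LPSolver n ℓ k Γ) := by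
  classical
  let past (x : Fin n → Item) (t s : Fin n) : Item := if s ≤ t then x s else ⟨0, 0⟩
  have hpast : ∀ x t, ∀ s ≤ t, past x t s = x s := fun x t s hs => if_pos hs
  have hex : ∀ (x : Fin n → Item) (t : Fin n), ∃ X : Fin n → ℝ,
      (∃ Y, LPFeasible ℓ k Γ x t Y) → LPOptimal ℓ k Γ x t X := fun x t => by
    by_cases h : ∃ Y, LPFeasible ℓ k Γ x t Y
    · obtain ⟨X, hX⟩ := exists_lpOptimal h
      exact ⟨X, fun _ => hX⟩
    · exact ⟨0, fun h' => absurd h' h⟩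
  choose sol hsol using hex
  refine ⟨⟨fun x t => sol (past x t) t, fun x t ⟨Y, hY⟩ => ?_, fun x y t h => ?_⟩⟩
  · exact (hsol _ t ⟨Y, hY.congr fun s hs => (hpast x t s hs).symm⟩).congr (hpast x t)
  · have : past x t = past y t := by
      funext s
      by_cases hs : s ≤ t
      · rw [hpast x t s hs, hpast y t s hs, h s hs]
      · simp only [past, if_neg hs]
    simp only [this]

end Solver

/-! ### Breaking ties among densities by random perturbations -/

section Perturbation

/-- Scaling of the value of an item; worthless items become empty. -/
def Item.scale (c : ℝ) (y : Item) : Item := if y.value = 0 then ⟨0, 0⟩ else ⟨y.value * c, y.size⟩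

theorem Item.Valid.scale {y : Item} (hy : y.Valid) {c : ℝ} (hc : 0 ≤ c) : (y.scale c).Valid := by
  unfold Item.scale
  split_ifs
  · exact ⟨le_rfl, le_rfl, zero_le_one⟩
  · exact ⟨mul_nonneg hy.1 hc, hy.2⟩

theorem Item.scale_value (c : ℝ) (y : Item) : (y.scale c).value = y.value * c := by
  unfold Item.scale
  split_ifs with h
  · simp [h]
  · rfl

theorem Item.Valid.scale_size_le {y : Item} (hy : y.Valid) (c : ℝ) :
    (y.scale c).size ≤ y.size := by
  unfold Item.scale
  split_ifs
  · exact hy.2.1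
  · exact le_rfl

theorem Item.scale_size {y : Item} (hy : y.value ≠ 0) (c : ℝ) : (y.scale c).size = y.size := by
  rw [Item.scale, if_neg hy]

theorem Item.value_ne_zero_of_scale {y : Item} {c : ℝ} (h : 0 < (y.scale c).size) :
    y.value ≠ 0 := by
  intro h0
  rw [Item.scale, if_pos h0] at h
  exact lt_irrefl _ h

open Classical in
/-- The algorithm that runs `A` on scaled values and ignores worthless items. -/
def OnlineAlg.scaled {n : ℕ} (A : OnlineAlg n) (c : Fin n → ℝ) : OnlineAlg n where
  select x := (A.select fun t => (x t).scale (c t)).filter fun t => (x t).value ≠ 0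
  online x y t h := by
    rw [mem_filter, mem_filter, h t le_rfl,
      A.online _ (fun t => (y t).scale (c t)) t fun s hs => by rw [h s hs]]

theorem OnlineAlg.mem_select_scaled {n : ℕ} {A : OnlineAlg n} {c : Fin n → ℝ} {x : Fin n → Item}
    {t : Fin n} : t ∈ (A.scaled c).select x ↔
      t ∈ A.select (fun t => (x t).scale (c t)) ∧ (x t).value ≠ 0 :=
  mem_filter

variable {n ℓ : ℕ} {k Γ : ℝ}

theorem OnlineAlg.Feasible.scaled {A : OnlineAlg n} (hA : A.Feasible k) {c : Fin n → ℝ}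
    (hc : ∀ t, 0 ≤ c t) : (A.scaled c).Feasible k := by
  classical
  intro x hx
  refine le_trans ?_ (hA _ fun t => (hx t).scale (hc t))
  refine (sum_le_sum fun t ht => ?_).trans
    (sum_le_sum_of_subset_of_nonneg (filter_subset _ _) fun t _ _ => ((hx t).scale (hc t)).2.1)
  exact (Item.scale_size (mem_filter.1 ht).2 _).ge

theorem OnlineAlg.sum_scaled_value_le {A : OnlineAlg n} {c : Fin n → ℝ} {b : ℝ}
    (hcb : ∀ t, c t ≤ b) (F : Finset (Fin n)) {x : Fin n → Item} (hx : ∀ t, (x t).Valid) :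
    ∑ t ∈ F with t ∈ A.select (fun t => (x t).scale (c t)), ((x t).scale (c t)).value ≤
      b * ∑ t ∈ F with t ∈ (A.scaled c).select x, (x t).value := by
  classical
  rw [sum_filter, sum_filter, mul_sum]
  refine sum_le_sum fun t _ => ?_
  by_cases h : t ∈ A.select (fun t => (x t).scale (c t))
  · by_cases h0 : (x t).value = 0
    · simp [Item.scale_value, h0]
    · rw [if_pos h, if_pos (OnlineAlg.mem_select_scaled.2 ⟨h, h0⟩), Item.scale_value, mul_comm]
      exact mul_le_mul_of_nonneg_right (hcb t) (hx t).1
  · rw [if_neg h, if_neg fun h' => h (OnlineAlg.mem_select_scaled.1 h').1, mul_zero]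

/-- Two independent uniform labels satisfy an equation with an injective side with probability at
most `1 / M`. -/
theorem prob_label_eq_le {α : Type*} [Fintype α] [DecidableEq α] {M : ℕ} [NeZero M] {s r : α}
    (hsr : s ≠ r) {f g : Fin M → ℝ} (hf : Function.Injective f) :
    prob (fun u : α → Fin M => f (u s) = g (u r)) ≤ 1 / M := by
  classical
  -- Shifting the label of s preserves the distribution; averaging over all shifts resamples this
  -- label with everything else fixed, and injectivity leaves at most one solution.
  have hshift : ∀ a : Fin M, prob (fun u : α → Fin M => f (u s) = g (u r)) =
      𝔼 u : α → Fin M, if f (u s + a) = g (u r) then 1 else 0 := fun a => by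
    rw [prob]
    symm
    refine Fintype.expect_equiv (Equiv.addRight (Pi.single s a)) _ _ fun u => ?_
    simp [hsr.symm]
  have h1 : prob (fun u : α → Fin M => f (u s) = g (u r)) =
      𝔼 u : α → Fin M, 𝔼 a : Fin M, if f (u s + a) = g (u r) then (1 : ℝ) else 0 := by
    rw [expect_comm, ← Fintype.expect_const (ι := Fin M)
      (prob (fun u : α → Fin M => f (u s) = g (u r)))]
    exact expect_congr rfl fun a _ => hshift a
  rw [h1]
  refine expect_le univ_nonempty fun u _ => ?_
  rw [Fintype.expect_eq_sum_div_card, Fintype.card_fin]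
  refine div_le_div_of_nonneg_right ?_ (Nat.cast_nonneg _)
  rw [sum_boole]
  have : #{a : Fin M | f (u s + a) = g (u r)} ≤ 1 := by
    refine card_le_one.2 fun a ha b hb => ?_
    have := hf (((mem_filter.1 ha).2).trans ((mem_filter.1 hb).2).symm)
    exact add_left_cancel this
  exact_mod_cast this

namespace Instance

variable {M N : ℕ}

/-- The scaling factor of a label. -/
def factor {M : ℕ} (a : Fin M) : ℝ := 1 + (a : ℝ) / (M : ℝ) ^ 2

theorem one_le_factor (a : Fin M) : 1 ≤ factor a := by
  unfold factor
  have : (0 : ℝ) ≤ (a : ℝ) / (M : ℝ) ^ 2 := by positivity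
  linarith

/-- Steps of 1/M² fit M distinct factors into a distortion of 1/M. -/
theorem factor_le [NeZero M] (a : Fin M) : factor a ≤ 1 + 1 / M := by
  unfold factor
  have hM : (0 : ℝ) < M := by exact_mod_cast NeZero.pos M
  have h1 : (a : ℝ) ≤ M := by exact_mod_cast a.isLt.le
  have h2 : (a : ℝ) / (M : ℝ) ^ 2 ≤ M / (M : ℝ) ^ 2 := div_le_div_of_nonneg_right h1 (by positivity)
  have h3 : (M : ℝ) / (M : ℝ) ^ 2 = 1 / M := by field_simp
  linarith

theorem factor_injective [NeZero M] : Function.Injective (factor (M := M)) := by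
  intro a b h
  have hM : (0 : ℝ) < (M : ℝ) ^ 2 := by
    have : (0 : ℝ) < M := by exact_mod_cast NeZero.pos M
    positivity
  have h1 : (a : ℝ) / (M : ℝ) ^ 2 = (b : ℝ) / (M : ℝ) ^ 2 := by
    unfold factor at h; linarith
  have h2 := (div_left_inj' hM.ne').1 h1
  exact Fin.ext (by exact_mod_cast h2)

variable (B : Instance n ℓ Γ (Fin N)) (e : Fin N ≃ (Fin n → Fin M))

/-- The permutation of the times that turns labels of items into labels of times. -/
def relabel {Ω : Type} (B : Instance n ℓ Γ Ω) (I : {t // t ∈ B.RO} ≃ Fin B.RO.card) :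
    Equiv.Perm (Fin n) :=
  Equiv.Perm.ofSubtype (I.trans B.RO.equivFin.symm)

theorem relabel_apply {Ω : Type} (B : Instance n ℓ Γ Ω)
    (I : {t // t ∈ B.RO} ≃ Fin B.RO.card) (t : {t // t ∈ B.RO}) :
    B.relabel I t = B.RO.equivFin.symm (I t) := by
  rw [relabel, Equiv.Perm.ofSubtype_apply_of_mem _ t.2]
  rfl

/-- The instance in which the items are scaled according to fixed labels. -/
def scaled (u : Fin n → Fin M) : Instance n ℓ Γ Unit where
  RO := B.RO
  cover := B.cover
  card_cover := B.card_cover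
  covers := B.covers
  item i := (B.item i).scale (factor (u (B.RO.equivFin.symm i)))
  item_valid i := (B.item_valid i).scale (zero_le_one.trans (one_le_factor _))
  adv I _ t := (B.adv I (e.symm (u ∘ B.relabel I)) t).scale (factor (u (B.relabel I t)))
  adv_valid _ _ _ := (B.adv_valid _ _ _).scale (zero_le_one.trans (one_le_factor _))

/-- Given the item labels u and the order I, the internal randomness is the labelling of times u ∘
`relabel I`. The adversary of the scaled instance knows I and can therefore imitate an adversary
that sees this randomness. -/
theorem scaled_arrival (u : Fin n → Fin M) (I : {t // t ∈ B.RO} ≃ Fin B.RO.card) (t : Fin n) :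
    (B.scaled e u).arrival I () t =
      (B.arrival I (e.symm (u ∘ B.relabel I)) t).scale (factor (u (B.relabel I t))) := by
  by_cases ht : t ∈ B.RO
  · have h1 : (B.scaled e u).arrival I () t = (B.scaled e u).item (I ⟨t, ht⟩) := dif_pos ht
    have h2 := B.relabel_apply I ⟨t, ht⟩
    rw [h1, arrival, dif_pos ht, h2]
    rfl
  · have h1 : (B.scaled e u).arrival I () t = (B.scaled e u).adv I () t := dif_neg ht
    rw [h1, arrival, dif_neg ht]
    rfl

theorem optRO_le_scaled (hk : 0 ≤ k) (u : Fin n → Fin M) :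
    B.optRO k ≤ (B.scaled e u).optRO k := by
  refine B.optRO_le hk fun X hX hXk => ?_
  refine le_trans (sum_le_sum fun i _ => ?_) ((B.scaled e u).le_optRO (X := X) hX ?_)
  · change _ ≤ ((B.item i).scale _).value * X i
    rw [Item.scale_value]
    exact mul_le_mul_of_nonneg_right
      (le_mul_of_one_le_right (B.item_valid i).1 (one_le_factor _)) (hX i).1
  · exact le_trans (sum_le_sum fun i _ =>
      mul_le_mul_of_nonneg_right ((B.item_valid i).scale_size_le _) (hX i).1) hXk

/-- Averaging over the labels of the times amounts to averaging over labels of the items. -/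
theorem expect_scaled_le [NeZero M] (A : OnlineAlg n) :
    𝔼 u : Fin n → Fin M, (B.scaled e u).expectedValue (fun _ => A) ≤
      (1 + 1 / M) * B.expectedValue fun ω => A.scaled fun t => factor (e ω t) := by
  have h1 : B.expectedValue (fun ω => A.scaled fun t => factor (e ω t)) =
      𝔼 u : Fin n → Fin M, 𝔼 I : {t // t ∈ B.RO} ≃ Fin B.RO.card,
        ∑ t ∈ B.RO with t ∈ (A.scaled fun t => factor (u (B.relabel I t))).select
          (B.arrival I (e.symm (u ∘ B.relabel I))),
          (B.arrival I (e.symm (u ∘ B.relabel I)) t).value := by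
    rw [expectedValue, expect_comm, expect_comm (univ : Finset (Fin n → Fin M))]
    refine expect_congr rfl fun I _ => ?_
    -- For fixed I, permuting coordinates is a bijection between labellings of times and of items.
    refine Fintype.expect_equiv (e.trans (Equiv.arrowCongr (B.relabel I) (Equiv.refl _))) _ _
      fun ω => ?_
    have h2 : (e.trans (Equiv.arrowCongr (B.relabel I) (Equiv.refl _))) ω ∘ B.relabel I = e ω := by
      funext t; simp
    rw [h2, Equiv.symm_apply_apply]
    have h3 : ∀ t, (e.trans (Equiv.arrowCongr (B.relabel I) (Equiv.refl _))) ω (B.relabel I t) =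
      e ω t := fun t => congrFun h2 t
    simp only [h3]
  rw [h1, mul_expect]
  refine expect_le_expect fun u _ => ?_
  rw [expectedValue_unit, mul_expect]
  refine expect_le_expect fun I _ => ?_
  have h4 : (B.scaled e u).arrival I () = fun t =>
      (B.arrival I (e.symm (u ∘ B.relabel I)) t).scale (factor (u (B.relabel I t))) :=
    funext fun t => B.scaled_arrival e u I t
  rw [h4]
  exact OnlineAlg.sum_scaled_value_le (fun t => factor_le _) _ fun t => B.arrival_valid _ _ _

/-- A union bound over ordered pairs. An item that keeps positive size after scaling has positive
value, so its scaled density is injective in its label; worthless items are emptied because scaling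
cannot separate their zero densities. -/
theorem prob_not_distinct_le [NeZero M] :
    prob (fun u : Fin n → Fin M => ¬ (B.scaled e u).DistinctDensities) ≤ (n : ℝ) ^ 2 / M := by
  classical
  have hM : (0 : ℝ) < M := by exact_mod_cast NeZero.pos M
  let p (ij : Fin B.RO.card × Fin B.RO.card) (u : Fin n → Fin M) : Prop :=
    ij.1 ≠ ij.2 ∧ 0 < (B.item ij.1).value / (B.item ij.1).size ∧
      (B.item ij.1).value / (B.item ij.1).size * factor (u (B.RO.equivFin.symm ij.1)) =
      (B.item ij.2).value / (B.item ij.2).size * factor (u (B.RO.equivFin.symm ij.2))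
  have hp : ∀ ij ∈ (univ : Finset (Fin B.RO.card × Fin B.RO.card)), prob (p ij) ≤ 1 / M := by
    rintro ⟨i, j⟩ -
    by_cases h : i ≠ j ∧ 0 < (B.item i).value / (B.item i).size
    · simp only [p, h.1, h.2, ne_eq, not_false_eq_true, true_and]
      refine prob_label_eq_le (s := ((B.RO.equivFin.symm i : {t // t ∈ B.RO}) : Fin n))
        (r := ((B.RO.equivFin.symm j : {t // t ∈ B.RO}) : Fin n)) ?_
        (f := fun a => (B.item i).value / (B.item i).size * factor a)
        (g := fun a => (B.item j).value / (B.item j).size * factor a) ?_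
      · intro hij
        exact h.1 (B.RO.equivFin.symm.injective (Subtype.ext hij))
      · intro a b hab
        exact factor_injective (mul_left_cancel₀ h.2.ne' hab)
    · have : ∀ u, ¬ p (i, j) u := fun u hu => h ⟨hu.1, hu.2.1⟩
      simp only [prob, this, if_false, expect_const_zero]
      positivity
  have hcard : (#(univ : Finset (Fin B.RO.card × Fin B.RO.card)) : ℝ) ≤ (n : ℝ) ^ 2 := by
    have : (B.RO.card : ℝ) ≤ n := by
      exact_mod_cast (card_le_univ B.RO).trans_eq (Fintype.card_fin n)
    rw [card_univ, Fintype.card_prod, Fintype.card_fin, sq]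
    push_cast
    exact mul_le_mul this this (Nat.cast_nonneg _) (Nat.cast_nonneg _)
  calc _ ≤ prob (fun u => ∃ ij ∈ (univ : Finset (Fin B.RO.card × Fin B.RO.card)), p ij u) := by
        refine prob_le_of_le (fun u => by split_ifs <;> norm_num) fun u hu => ?_
        rw [if_pos]
        unfold DistinctDensities at hu
        push Not at hu
        obtain ⟨i, j, hij, hi, hj, heq⟩ := hu
        have hvi := Item.value_ne_zero_of_scale hi
        have hvj := Item.value_ne_zero_of_scale hj
        refine ⟨(i, j), mem_univ _, hij, ?_, ?_⟩
        · refine div_pos (lt_of_le_of_ne (B.item_valid i).1 hvi.symm) ?_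
          exact (Item.scale_size hvi _).symm ▸ hi
        · change ((B.item i).scale _).value / ((B.item i).scale _).size =
            ((B.item j).scale _).value / ((B.item j).scale _).size at heq
          rw [Item.scale_value, Item.scale_value, Item.scale_size hvi, Item.scale_size hvj,
            mul_div_right_comm, mul_div_right_comm] at heq
          exact heq
    _ ≤ #(univ : Finset (Fin B.RO.card × Fin B.RO.card)) * (1 / M : ℝ) := prob_exists_le _ _ hp
    _ ≤ (n : ℝ) ^ 2 * (1 / M) := mul_le_mul_of_nonneg_right hcard (by positivity)
    _ = _ := by ring

/-- Random perturbations extend a guarantee for distinct densities to all instances. -/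
theorem le_expectedValue_scaled [NeZero M] {A : OnlineAlg n} (hk : 1 ≤ k) (hM : (n : ℝ) ^ 2 * k ≤ M)
    (hn : 1 ≤ n) {q : ℝ} (hq0 : 0 ≤ q) (hq1 : q ≤ 1)
    (h : ∀ B' : Instance n ℓ Γ Unit, B'.DistinctDensities →
      q * B'.optRO k ≤ B'.expectedValue fun _ => A) :
    (q - 2 / k) * B.optRO k ≤ B.expectedValue fun ω => A.scaled fun t => factor (e ω t) := by
  classical
  have hM0 : (0 : ℝ) < M := by exact_mod_cast NeZero.pos M
  have hO := B.optRO_nonneg k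
  have hE := B.expectedValue_nonneg fun ω => A.scaled fun t => factor (e ω t)
  set E := B.expectedValue fun ω => A.scaled fun t => factor (e ω t)
  have h1 := B.expect_scaled_le e A
  have h2 : q * B.optRO k * (1 - prob (fun u : Fin n → Fin M =>
      ¬ (B.scaled e u).DistinctDensities)) ≤
      𝔼 u : Fin n → Fin M, (B.scaled e u).expectedValue (fun _ => A) := by
    have h3 : 1 - prob (fun u : Fin n → Fin M => ¬ (B.scaled e u).DistinctDensities) =
        𝔼 u : Fin n → Fin M, if (B.scaled e u).DistinctDensities then (1 : ℝ) else 0 := by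
      rw [prob, sub_eq_iff_eq_add, ← expect_add_distrib, ← Fintype.expect_const (ι := Fin n → Fin M) (1 : ℝ)]
      refine expect_congr rfl fun u _ => ?_
      by_cases hu : (B.scaled e u).DistinctDensities <;> simp [hu]
    rw [h3, mul_expect]
    refine expect_le_expect fun u _ => ?_
    split_ifs with hu
    · rw [mul_one]
      exact (mul_le_mul_of_nonneg_left (B.optRO_le_scaled e (by linarith) u) hq0).trans (h _ hu)
    · rw [mul_zero]; exact expectedValue_nonneg _ _
  have h3 := B.prob_not_distinct_le e
  have hn' : (1 : ℝ) ≤ (n : ℝ) ^ 2 := by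
    have : (1 : ℝ) ≤ n := by exact_mod_cast hn
    nlinarith
  have h4 : (n : ℝ) ^ 2 / M ≤ 1 / k := by
    rw [div_le_div_iff₀ hM0 (by linarith)]; linarith
  have h5 : (1 : ℝ) / M ≤ 1 / k := by
    refine le_trans ?_ h4
    exact div_le_div_of_nonneg_right hn' hM0.le
  set d := 1 / k with hd
  have hd0 : 0 ≤ d := by positivity
  have h6 : q * B.optRO k * (1 - d) ≤ (1 + d) * E := by
    have h7 : q * B.optRO k * (1 - d) ≤ q * B.optRO k * (1 - prob (fun u : Fin n → Fin M =>
      ¬ (B.scaled e u).DistinctDensities)) :=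
      mul_le_mul_of_nonneg_left (by linarith) (mul_nonneg hq0 hO)
    have h8 : (1 + 1 / (M : ℝ)) * E ≤ (1 + d) * E := mul_le_mul_of_nonneg_right (by linarith) hE
    linarith
  have e2 : 2 / k = 2 * d := by rw [hd]; ring
  rw [e2]
  -- One d pays for the probability of ties, the other for the distortion of the values; this uses q
  -- ≤ 1.
  have h9 : (1 + d) * ((q - 2 * d) * B.optRO k) ≤ q * B.optRO k * (1 - d) := by
    have : q * (1 - d) - (1 + d) * (q - 2 * d) = 2 * d * (1 - q) + 2 * d ^ 2 := by ring
    have h10 : 0 ≤ 2 * d * (1 - q) + 2 * d ^ 2 := by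
      have := mul_nonneg hd0 (sub_nonneg.2 hq1)
      positivity
    nlinarith [mul_nonneg h10 hO]
  exact le_of_mul_le_mul_left (h9.trans h6) (by linarith)

end Instance

end Perturbation

end BARO

end

/-! ### The main theorem -/

theorem theorem1 :
    ∃ a₀ : ℝ, ∀ a₄ : ℝ, a₀ ≤ a₄ → ∃ C : ℝ, 0 < C ∧
      ∀ (n ℓ : ℕ) (k Γ : ℝ), 80 ≤ k → k ≤ (n : ℝ) / 2 →
        |(ℓ : ℝ) - n * Real.log k / k| < 1 → Real.sqrt k ≤ Γ → Γ * ℓ / n ≤ 1 / 2 →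
        -- the primal algorithm, with an arbitrary rule for choosing optimal solutions
        (∀ S : BARO.LPSolver n ℓ k Γ,
          (BARO.primalAlg a₄ S).Feasible k ∧
          ∀ B : BARO.Instance n ℓ Γ Unit, B.DistinctDensities →
            B.Attains (fun _ => BARO.primalAlg a₄ S) k C) ∧
        -- some randomized online algorithm, with ties among the value densities allowed
        (∃ N : ℕ, 0 < N ∧ ∃ A : Fin N → BARO.OnlineAlg n,
          (∀ ω, (A ω).Feasible k) ∧
          ∀ B : BARO.Instance n ℓ Γ (Fin N), B.Attains A k C) := by
  refine ⟨601, fun a₄ ha => ?_⟩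
  set c : ℝ := 2 * (1226 + a₄ + 10 * Real.exp 33) + 609 with hc
  have hc0 : 0 < c := by
    have := Real.exp_pos 33
    linarith
  -- The summand 4 absorbs the loss 2/k of tie breaking: 1/k ≤ Γℓ/n, and the logarithm is at least
  -- 1/2. The factor 4 is the ratio of the two error terms in `error_le`.
  refine ⟨4 * (c + 4), by linarith, fun n ℓ k Γ hk hkn hℓ hΓ hb => ?_⟩
  have hfirst : ∀ (S : BARO.LPSolver n ℓ k Γ) (B : BARO.Instance n ℓ Γ Unit),
      B.DistinctDensities → (1 - c * ((Γ * ℓ / n) * Real.log (n / (Γ * ℓ)))) * B.optRO k ≤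
        B.expectedValue fun _ => BARO.primalAlg a₄ S := fun S B hd =>
    B.le_expectedValue_primalAlg (B.regime hk hkn hℓ hΓ hb) hd ha S
  have R₀ : BARO.Regime n ℓ n k Γ := by
    refine BARO.Regime.of_params hk hkn hℓ hΓ hb le_rfl fun _ => ?_
    have : 0 ≤ Γ * (ℓ : ℝ) := mul_nonneg ((Real.sqrt_nonneg k).trans hΓ) (Nat.cast_nonneg _)
    linarith
  have hε : 0 ≤ Γ * ℓ / n := (by positivity : 0 ≤ 1 / k).trans R₀.inv_le
  have herr : 0 ≤ Γ * ℓ / n * Real.log (n / (Γ * ℓ)) := mul_nonneg hε (by linarith [R₀.log_ge])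
  refine ⟨fun S => ⟨BARO.primalAlg_feasible (by linarith), fun B hd => ?_⟩, ?_⟩
  · refine BARO.Instance.attains_of_le (B.regime hk hkn hℓ hΓ hb) hℓ (by linarith) ?_
    exact (mul_le_mul_of_nonneg_right (by linarith) (B.optRO_nonneg k)).trans (hfirst S B hd)
  · obtain ⟨S⟩ := BARO.nonempty_lpSolver n ℓ k Γ
    set M : ℕ := ⌈(n : ℝ) ^ 2 * k⌉₊ + 1 with hM
    have hnM : (n : ℝ) ^ 2 * k ≤ M := by
      rw [hM]; push_cast
      linarith [Nat.le_ceil ((n : ℝ) ^ 2 * k)]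
    have hn : 1 ≤ n := by
      have := R₀.n_pos
      exact_mod_cast this
    have e : Fin (Fintype.card (Fin n → Fin M)) ≃ (Fin n → Fin M) :=
      (Fintype.equivFin _).symm
    refine ⟨Fintype.card (Fin n → Fin M), Fintype.card_pos,
      fun ω => (BARO.primalAlg a₄ S).scaled fun t => BARO.Instance.factor (e ω t),
      fun ω => (BARO.primalAlg_feasible (by linarith)).scaled fun t =>
        zero_le_one.trans (BARO.Instance.one_le_factor _), fun B => ?_⟩
    refine BARO.Instance.attains_of_le (B.regime hk hkn hℓ hΓ hb) hℓ (by linarith) ?_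
    have hO := B.optRO_nonneg k
    -- The perturbation lemma needs a nonnegative ratio; a nonpositive one promises nothing.
    rcases le_or_gt (1 - c * ((Γ * ℓ / n) * Real.log (n / (Γ * ℓ)))) 0 with hq | hq
    · exact (mul_nonpos_of_nonpos_of_nonneg (by linarith) hO).trans (B.expectedValue_nonneg _)
    · refine le_trans (mul_le_mul_of_nonneg_right ?_ hO)
        (B.le_expectedValue_scaled e (by linarith) hnM hn hq.le
          (sub_le_self _ (mul_nonneg hc0.le herr)) (hfirst S))
      have h1 : 2 / k ≤ 2 * (Γ * ℓ / n) := by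
        have h2 := R₀.inv_le
        have e2 : 2 / k = 2 * (1 / k) := by ring
        linarith
      have h2 : Γ * ℓ / n ≤ 2 * (Γ * ℓ / n * Real.log (n / (Γ * ℓ))) := by
        have := R₀.log_ge
        nlinarith
      linarith
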